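/- Let $d\ge 2$. Let $\mathcal K_d$ be the set of convex, compact subsets of $\mathbb R^d$ with non-empty interior, equipped with the Hausdorff distance. An *affine point* is a continuous map $p:\mathcal K_d\to\mathbb R^d$ with $p(T(C))=T(p(C))$ for every $C\in\mathcal K_d$ and every invertible affine map $T$ of $\mathbb R^d$; let $\mathfrak P_d$ be the set of affine points, equipped with the distance $$\mathrm{dist}(p,q)=\sup_{B\subseteq C\subseteq dB}\|p(C)-q(C)\|_2 ,$$ where the supremum is over $C\in\mathcal K_d$ and $B$ is the closed Euclidean unit ball. For $C\in\mathcal K_d$ and $z\in\mathrm{int}(C)$ put $(C-z)^\circ=\{y:\langle x-z,y\rangle\le 1\text{ for all }x\in C\}\in\mathcal K_d$. An affine point $q$ is *dual* to an affine point $p$ if $q((C-p(C))^\circ)=0$ for every $C\in\mathcal K_d$ for which this is defined, i.e. with $p(C)\in\mathrm{int}(C)$. Then there is an open and dense set $W\subseteq\mathfrak P_d$ such that no $p\in W$ has a dual affine point. -/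

import Mathlib

open scoped RealInnerProductSpace

namespace AffinePoints

/-- Euclidean space `ℝ^d`. -/
abbrev Space (d : ℕ) : Type := EuclideanSpace ℝ (Fin d)

/-- The `d`-dimensional convex bodies: convex compact subsets of `ℝ^d` with non-empty interior.
As a subtype of Mathlib's `ConvexBody` it carries the Hausdorff distance. -/
abbrev Body (d : ℕ) : Type :=
  {C : ConvexBody (Space d) // (interior (C : Set (Space d))).Nonempty}

/-- The set of points of a convex body. -/
abbrev Body.toSet {d : ℕ} (C : Body d) : Set (Space d) := (C.1 : Set (Space d))

/-- The image `T(C)` of a convex body under an invertible affine map of `ℝ^d`. -/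
def Body.map {d : ℕ} (T : Space d ≃ᵃ[ℝ] Space d) (C : Body d) : Body d :=
  ⟨{ carrier := T '' C.toSet
     convex' := C.1.convex.affine_image T.toAffineMap
     isCompact' := C.1.isCompact.image T.toAffineMap.continuous_of_finiteDimensional
     nonempty' := C.1.nonempty.image T },
   by
    have h : T '' interior C.toSet = interior (T '' C.toSet) :=
      (AffineEquiv.toContinuousAffineEquiv T).toHomeomorph.image_interior C.toSet
    change (interior (T '' C.toSet)).Nonempty
    rw [← h]
    exact C.2.image T⟩

/-- An affine (invariant) point: a map from convex bodies to `ℝ^d`, continuous for the Hausdorff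
distance and the Euclidean norm, with `p(T(C)) = T(p(C))` for all invertible affine `T`. -/
structure AffinePoint (d : ℕ) where
  toFun : Body d → Space d
  continuous_toFun : Continuous toFun
  map_map' : ∀ (T : Space d ≃ᵃ[ℝ] Space d) (C : Body d), toFun (C.map T) = T (toFun C)

instance (d : ℕ) : CoeFun (AffinePoint d) (fun _ => Body d → Space d) := ⟨AffinePoint.toFun⟩

/-! ### The distance of affine points -/

/-- The convex bodies `C` with `B ⊆ C ⊆ dB`, where `B` is the closed Euclidean unit ball. -/
def pinched (d : ℕ) : Set (Body d) :=
  {C | Metric.closedBall 0 1 ⊆ C.toSet ∧ C.toSet ⊆ Metric.closedBall 0 (d : ℝ)}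

/-- The distance `sup_{B ⊆ C ⊆ dB} ‖p(C) - q(C)‖`; the supremum is over a bounded set of reals,
see `bddAbove_norm_sub`. -/
noncomputable instance (d : ℕ) : Dist (AffinePoint d) :=
  ⟨fun p q => ⨆ C : pinched d, ‖p C.1 - q C.1‖⟩

theorem dist_def {d : ℕ} (p q : AffinePoint d) :
    dist p q = ⨆ C : pinched d, ‖p C.1 - q C.1‖ := rfl

open TopologicalSpace in
/-- A convex body as a non-empty compact set. -/
def Body.toNonemptyCompacts {d : ℕ} (C : Body d) : NonemptyCompacts (Space d) :=
  ⟨⟨C.toSet, C.1.isCompact⟩, C.1.nonempty⟩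

theorem isometry_toNonemptyCompacts (d : ℕ) : Isometry (Body.toNonemptyCompacts (d := d)) :=
  Isometry.of_dist_eq fun _ _ => rfl

open TopologicalSpace in
theorem isCompact_pinched (d : ℕ) : IsCompact (pinched d) := by
  set S : Set (NonemptyCompacts (Space d)) :=
    {K | (K : Set (Space d)) ⊆ Metric.closedBall 0 (d : ℝ)} ∩
      ({K | ∀ x ∈ Metric.closedBall (0 : Space d) 1, Metric.infDist x K ≤ 0} ∩
       {K | ∀ (x y : Space d) (a b : ℝ), 0 ≤ a → 0 ≤ b → a + b = 1 →
        Metric.infDist (a • x + b • y) K ≤ a * Metric.infDist x K + b * Metric.infDist y K})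
    with hS
  have hcont (x : Space d) :
      Continuous fun K : NonemptyCompacts (Space d) => Metric.infDist x (K : Set (Space d)) :=
    (Metric.lipschitz_infDist_set x).continuous
  have hmem (K : NonemptyCompacts (Space d)) (x : Space d) :
      Metric.infDist x (K : Set (Space d)) ≤ 0 ↔ x ∈ K := by
    have h := K.isCompact.isClosed.mem_iff_infDist_zero (x := x) K.nonempty
    constructor
    · intro hx
      exact h.2 (le_antisymm hx Metric.infDist_nonneg)
    · intro hx
      exact (h.1 hx).le
  have hScompact : IsCompact S := by
    refine (NonemptyCompacts.isCompact_subsets_of_isCompact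
      (isCompact_closedBall 0 (d : ℝ))).inter_right (IsClosed.inter ?_ ?_)
    · simp only [Set.ofPred_forall]
      exact isClosed_iInter fun x => isClosed_iInter fun _ =>
        isClosed_le (hcont x) continuous_const
    · simp only [Set.ofPred_forall]
      refine isClosed_iInter fun x => isClosed_iInter fun y => isClosed_iInter fun a =>
        isClosed_iInter fun b => isClosed_iInter fun _ => isClosed_iInter fun _ =>
        isClosed_iInter fun _ => isClosed_le (hcont _) ?_
      exact (continuous_const.mul (hcont x)).add (continuous_const.mul (hcont y))
  have himage : pinched d = Body.toNonemptyCompacts ⁻¹' S := by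
    ext C
    have hmC (x : Space d) : x ∈ C.toNonemptyCompacts ↔ x ∈ C.toSet := Iff.rfl
    constructor
    · rintro ⟨h1, h2⟩
      refine ⟨h2, fun x hx => (hmem _ _).2 (h1 hx), fun x y a b ha hb hab => ?_⟩
      obtain ⟨u, hu, hxu⟩ := C.1.isCompact.exists_infDist_eq_dist C.1.nonempty x
      obtain ⟨v, hv, hyv⟩ := C.1.isCompact.exists_infDist_eq_dist C.1.nonempty y
      change Metric.infDist _ C.toSet ≤ a * Metric.infDist x C.toSet + b * Metric.infDist y C.toSet
      rw [hxu, hyv]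
      refine (Metric.infDist_le_dist_of_mem (C.1.convex hu hv ha hb hab)).trans ?_
      rw [dist_eq_norm, dist_eq_norm, dist_eq_norm]
      calc ‖a • x + b • y - (a • u + b • v)‖ = ‖a • (x - u) + b • (y - v)‖ := by
            congr 1; module
        _ ≤ ‖a • (x - u)‖ + ‖b • (y - v)‖ := norm_add_le _ _
        _ = a * ‖x - u‖ + b * ‖y - v‖ := by
            rw [norm_smul, norm_smul, Real.norm_of_nonneg ha, Real.norm_of_nonneg hb]
    · rintro ⟨h1, h2, -⟩
      exact ⟨fun x hx => (hmem _ _).1 (h2 x hx), h1⟩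
  rw [himage]
  refine (isometry_toNonemptyCompacts d).isEmbedding.isInducing.isCompact_preimage' hScompact ?_
  rintro K ⟨h1, h2, h3⟩
  have hball : Metric.closedBall (0 : Space d) 1 ⊆ (K : Set (Space d)) :=
    fun x hx => (hmem _ _).1 (h2 x hx)
  refine ⟨⟨⟨K, ?_, K.isCompact, K.nonempty⟩, ⟨0, ?_⟩⟩, rfl⟩
  · intro x hx y hy a b ha hb hab
    refine (hmem _ _).1 ((h3 x y a b ha hb hab).trans ?_)
    have hx' := (hmem K x).2 hx
    have hy' := (hmem K y).2 hy
    nlinarith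
  · exact interior_mono hball
      (Metric.ball_subset_interior_closedBall (Metric.mem_ball_self one_pos))

theorem bddAbove_norm_sub {d : ℕ} (p q : AffinePoint d) :
    BddAbove (Set.range fun C : pinched d => ‖p C.1 - q C.1‖) := by
  have h := (isCompact_pinched d).bddAbove_image
    ((p.continuous_toFun.sub q.continuous_toFun).norm.continuousOn)
  rwa [Set.image_eq_range] at h

/-- The (pseudo-)metric space of affine points; its topology is the one in which "open" and "dense"
are understood. -/
noncomputable instance (d : ℕ) : PseudoMetricSpace (AffinePoint d) where
  dist_self p := by simp [dist_def]
  dist_comm p q := by simp only [dist_def, norm_sub_rev]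
  dist_triangle p q r := by
    refine Real.iSup_le (fun C => ?_) (add_nonneg
      (Real.iSup_nonneg fun _ => norm_nonneg _) (Real.iSup_nonneg fun _ => norm_nonneg _))
    exact (norm_sub_le_norm_sub_add_norm_sub _ _ _).trans
      (add_le_add (le_ciSup (bddAbove_norm_sub p q) C) (le_ciSup (bddAbove_norm_sub q r) C))

/-! ### Polar bodies and duality -/

/-- The polar set `S° = {y : ⟪x, y⟫ ≤ 1 for all x ∈ S}`. -/
def polarSet {d : ℕ} (S : Set (Space d)) : Set (Space d) :=
  {y | ∀ x ∈ S, ⟪x, y⟫ ≤ 1}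

/-- The polar `(C - z)°` with respect to an interior point `z` of the convex body `C`;
it is again a convex body. -/
def Body.polarAt {d : ℕ} (C : Body d) (z : Space d) (hz : z ∈ interior C.toSet) : Body d :=
  ⟨{ carrier := polarSet ((fun x => x - z) '' C.toSet)
     convex' := by
      intro y hy y' hy' a b ha hb hab x hx
      have h1 := hy x hx
      have h2 := hy' x hx
      rw [inner_add_right, real_inner_smul_right, real_inner_smul_right]
      nlinarith
     isCompact' := by
      have hclosed : IsClosed (polarSet ((fun x => x - z) '' C.toSet)) := by
        simp only [polarSet, Set.ofPred_forall]
        exact isClosed_iInter fun x => isClosed_iInter fun _ =>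
          isClosed_le (continuous_const.inner continuous_id) continuous_const
      obtain ⟨r, hr, hball⟩ := Metric.isOpen_iff.1 isOpen_interior z hz
      refine Metric.isCompact_of_isClosed_isBounded hclosed
        ((Metric.isBounded_closedBall (x := (0 : Space d)) (r := 2 / r)).subset fun y hy => ?_)
      rw [mem_closedBall_zero_iff]
      by_contra! hlt
      have hy0 : 0 < ‖y‖ := lt_trans (by positivity) hlt
      have hmem : z + (r / (2 * ‖y‖)) • y ∈ C.toSet := by
        refine interior_subset (hball ?_)
        rw [Metric.mem_ball, dist_eq_norm, add_sub_cancel_left, norm_smul,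
          Real.norm_of_nonneg (by positivity)]
        have : r / (2 * ‖y‖) * ‖y‖ = r / 2 := by field_simp
        linarith
      have h := hy _ ⟨_, hmem, rfl⟩
      simp only [add_sub_cancel_left] at h
      rw [real_inner_smul_left, real_inner_self_eq_norm_sq] at h
      have h' : r / (2 * ‖y‖) * ‖y‖ ^ 2 = r * ‖y‖ / 2 := by field_simp
      rw [h'] at h
      rw [div_lt_iff₀ hr] at hlt
      linarith
     nonempty' := ⟨0, fun x _ => by simp⟩ },
   by
    obtain ⟨R, hR⟩ := (C.1.isCompact.image
      (continuous_id.sub continuous_const : Continuous fun x : Space d => x - z)).isBounded.exists_norm_le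
    refine ⟨0, mem_interior_iff_mem_nhds.2 (Filter.mem_of_superset
      (Metric.closedBall_mem_nhds (0 : Space d) (ε := (|R| + 1)⁻¹) (by positivity)) ?_)⟩
    intro y hy x hx
    rw [mem_closedBall_zero_iff] at hy
    have hx' : ‖x‖ ≤ |R| + 1 := by
      linarith [hR x hx, le_abs_self R]
    calc ⟪x, y⟫ ≤ ‖x‖ * ‖y‖ := real_inner_le_norm _ _
      _ ≤ (|R| + 1) * (|R| + 1)⁻¹ := by gcongr
      _ = 1 := mul_inv_cancel₀ (by positivity)⟩

/-- `q` is dual to `p` if `q((C - p(C))°) = 0` for every convex body `C` for which this expression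
is defined. The polar `(C - p(C))°` is a convex body exactly if `p(C)` is an interior point of
`C`; if `p` is proper, i.e. `p(C)` is interior to `C` for all `C`, every `C` is admitted. -/
def AffinePoint.IsDual {d : ℕ} (p q : AffinePoint d) : Prop :=
  ∀ (C : Body d) (h : p C ∈ interior C.toSet), q (C.polarAt (p C) h) = 0

end AffinePoints

open scoped RealInnerProductSpace

namespace AffinePoints

open Filter Topology MeasureTheory

/-! Everything is tested on simplices truncated at one vertex, C_t = {x ≥ 0, t ≤ ∑ xᵢ ≤ 1} with 0 <
t ≤ 1/4. By permutation symmetry p(C_t) lies on the diagonal, so p enters only through the number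
Q(t) = ∑ p(C_t)ᵢ. The polar of C_t at p(C_t) is a bipyramid over a simplex. By symmetry its affine
type is fixed by the ratio in which the base divides the axis, and under polarity this ratio becomes
the cross-ratio of 0, t, Q(t), 1. If the cross-ratios at t₁ and t₂ agree, an affine map Φ carries
one polar to the other. A dual point is 0 on both, so Φ fixes 0, and this forces t₁ = t₂
(`AffinePoint.IsDual.eq_of_crossRatio_eq`). Thus a dual makes the cross-ratio injective in t as long
as t < Q(t) < 1; being continuous, it then cannot have a dip
(`AffinePoint.HasDip.not_exists_isDual`).

Dips are stable: one affine map puts all C_t between B and dB, so Q(t) is Lipschitz in p, uniformly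
in t (`exists_abs_coordSum_sub_le`).

Dips are dense: p is replaced by p - δ ψ(R) V, with R an affine invariant number, V an equivariant
vector and ψ a tent function. If V(C_s) ≠ 0 and R(C_t) < R(C_s) for t slightly below s, the tent can
move Q at an intermediate t₂ while leaving it unchanged at t₁ and s
(`AffinePoint.exists_dist_lt_hasDip`). Such R and V come from the core of C, the part that the
homothety of ratio -κ at the centroid maps into C: R is its relative volume, V its moment about the
centroid. The centroid of C_t is explicit, and κ is tuned so that the core is all of C_b but misses
corners of C_t for t slightly below b (`exists_coreMoment_ne_zero`). -/

theorem Body.ext_toSet {d : ℕ} {C C' : Body d} (h : C.toSet = C'.toSet) : C = C' :=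
  Subtype.ext (SetLike.coe_injective h)

theorem Body.map_eq_of_forall_mem_iff {d : ℕ} (T : Space d ≃ᵃ[ℝ] Space d) {C C' : Body d}
    (h : ∀ x, T x ∈ C'.toSet ↔ x ∈ C.toSet) : C.map T = C' := by
  refine Body.ext_toSet ?_
  change T '' C.toSet = C'.toSet
  ext y
  constructor
  · rintro ⟨x, hx, rfl⟩
    exact (h x).2 hx
  · intro hy
    refine ⟨T.symm y, (h _).1 ?_, T.apply_symm_apply y⟩
    rwa [T.apply_symm_apply]

theorem Body.mem_map_iff {d : ℕ} (T : Space d ≃ᵃ[ℝ] Space d) (C : Body d) (x : Space d) :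
    T x ∈ (C.map T).toSet ↔ x ∈ C.toSet :=
  T.injective.mem_set_image

/-! ### Affine maps commuting with the permutations of the coordinates -/

/-- The sum of the coordinates. -/
noncomputable def coordSum (d : ℕ) : Space d →L[ℝ] ℝ := ∑ i, EuclideanSpace.proj i

theorem coordSum_apply {d : ℕ} (x : Space d) : coordSum d x = ∑ i, x i := by
  simp [coordSum]

@[simp] theorem coordSum_single {d : ℕ} (i : Fin d) (t : ℝ) :
    coordSum d (EuclideanSpace.single i t) = t := by
  simp [coordSum_apply]

/-- The vector all of whose coordinates are `t`. -/
noncomputable def diag (d : ℕ) (t : ℝ) : Space d := WithLp.toLp 2 fun _ => t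

@[simp] theorem diag_apply {d : ℕ} (t : ℝ) (i : Fin d) : diag d t i = t := rfl

@[simp] theorem coordSum_diag {d : ℕ} (t : ℝ) : coordSum d (diag d t) = d * t := by
  simp [coordSum_apply]

/-- The linear map `x ↦ α x + β (∑ xᵢ) (1, …, 1)`. -/
noncomputable def axialLinear (d : ℕ) (α β : ℝ) (hα : α ≠ 0) (hβ : α + d * β ≠ 0) :
    Space d ≃ₗ[ℝ] Space d where
  toFun x := α • x + diag d (β * coordSum d x)
  map_add' x y := by ext i; simp; ring
  map_smul' c x := by ext i; simp; ring
  invFun y := α⁻¹ • (y - diag d (β / (α + d * β) * coordSum d y))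
  left_inv x := by
    ext i
    simp only [map_add, map_smul, coordSum_diag, PiLp.smul_apply, PiLp.sub_apply, PiLp.add_apply,
      diag_apply, smul_eq_mul]
    rw [show α * coordSum d x + d * (β * coordSum d x) = (α + d * β) * coordSum d x by ring,
      ← mul_assoc, div_mul_cancel₀ _ hβ, add_sub_cancel_right, inv_mul_cancel_left₀ hα]
  right_inv x := by
    ext i
    simp only [map_sub, map_smul, coordSum_diag, PiLp.smul_apply, PiLp.sub_apply, PiLp.add_apply,
      diag_apply, smul_eq_mul]
    have h : coordSum d x - d * (β / (α + d * β) * coordSum d x)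
        = α * (coordSum d x / (α + d * β)) := by
      rw [div_mul_eq_mul_div, mul_div_assoc]
      have := div_mul_cancel₀ (coordSum d x) hβ
      linear_combination -this
    rw [h, inv_mul_cancel_left₀ hα, mul_inv_cancel_left₀ hα]
    ring

/-- The affine map `x ↦ α x + β (∑ xᵢ) (1, …, 1) + γ (1, …, 1)`. -/
noncomputable def axial (d : ℕ) (α β γ : ℝ) (hα : α ≠ 0) (hβ : α + d * β ≠ 0) :
    Space d ≃ᵃ[ℝ] Space d :=
  (axialLinear d α β hα hβ).toAffineEquiv.trans (AffineEquiv.constVAdd ℝ _ (diag d γ))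

theorem axial_apply {d : ℕ} {α β γ : ℝ} (hα : α ≠ 0) (hβ : α + d * β ≠ 0) (x : Space d)
    (i : Fin d) : axial d α β γ hα hβ x i = α * x i + β * coordSum d x + γ := by
  simp [axial, axialLinear]; ring

theorem coordSum_axial {d : ℕ} {α β γ : ℝ} (hα : α ≠ 0) (hβ : α + d * β ≠ 0) (x : Space d) :
    coordSum d (axial d α β γ hα hβ x) = (α + d * β) * coordSum d x + d * γ := by
  rw [coordSum_apply]
  simp_rw [axial_apply]
  rw [Finset.sum_add_distrib, Finset.sum_add_distrib, ← Finset.mul_sum, ← coordSum_apply]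
  simp; ring

/-- The permutation of the coordinates, as an affine map. -/
noncomputable def permCoord (d : ℕ) (e : Equiv.Perm (Fin d)) : Space d ≃ᵃ[ℝ] Space d :=
  (LinearIsometryEquiv.piLpCongrLeft 2 ℝ ℝ e).toLinearEquiv.toAffineEquiv

theorem permCoord_apply {d : ℕ} (e : Equiv.Perm (Fin d)) (x : Space d) (i : Fin d) :
    permCoord d e x i = x (e.symm i) := by
  simp [permCoord, LinearIsometryEquiv.piLpCongrLeft_apply, Equiv.piCongrLeft']

theorem coordSum_permCoord {d : ℕ} (e : Equiv.Perm (Fin d)) (x : Space d) :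
    coordSum d (permCoord d e x) = coordSum d x := by
  simp only [coordSum_apply, permCoord_apply]
  exact Equiv.sum_comp e.symm fun i => x i

/-- The affine involution replacing the `i`-th coordinate by `1 - ∑ xⱼ`. -/
noncomputable def swapApex (d : ℕ) (i : Fin d) : Space d ≃ᵃ[ℝ] Space d :=
  (LinearEquiv.ofInvolutive
    (LinearMap.id - (LinearMap.toSpanSingleton ℝ (Space d) (EuclideanSpace.single i 1)).comp
      ((coordSum d).toLinearMap + (EuclideanSpace.proj i : Space d →L[ℝ] ℝ).toLinearMap))
    (fun x => by
      ext j
      by_cases h : j = i <;> simp [h, coordSum_single])).toAffineEquiv.trans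
    (AffineEquiv.constVAdd ℝ _ (EuclideanSpace.single i 1))

theorem swapApex_apply {d : ℕ} (i : Fin d) (x : Space d) :
    swapApex d i x = x + EuclideanSpace.single i (1 - coordSum d x - x i) := by
  change EuclideanSpace.single i 1 + (x - (coordSum d x + x i) • EuclideanSpace.single i 1) = _
  ext j
  by_cases h : j = i
  · subst h
    simp; ring
  · simp [h]

theorem swapApex_apply_self {d : ℕ} (i : Fin d) (x : Space d) :
    swapApex d i x i = 1 - coordSum d x := by
  simp [swapApex_apply]

theorem swapApex_apply_of_ne {d : ℕ} {i j : Fin d} (h : j ≠ i) (x : Space d) :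
    swapApex d i x j = x j := by
  simp [swapApex_apply, h]

theorem coordSum_swapApex {d : ℕ} (i : Fin d) (x : Space d) :
    coordSum d (swapApex d i x) = 1 - x i := by
  simp [swapApex_apply, coordSum_single]; ring

/-! ### Truncated simplices -/

/-- The set `{x ≥ 0, t ≤ ∑ xᵢ ≤ 1}`. -/
def truncSet (d : ℕ) (t : ℝ) : Set (Space d) :=
  {x | (∀ i, 0 ≤ x i) ∧ t ≤ coordSum d x ∧ coordSum d x ≤ 1}

theorem convex_truncSet {d : ℕ} (t : ℝ) : Convex ℝ (truncSet d t) := by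
  rintro x ⟨h1, h2, h3⟩ y ⟨h1', h2', h3'⟩ a b ha hb hab
  have e : coordSum d (a • x + b • y) = a * coordSum d x + b * coordSum d y := by simp
  refine ⟨fun i => ?_, ?_, ?_⟩
  · have := h1 i
    have := h1' i
    simp only [PiLp.add_apply, PiLp.smul_apply, smul_eq_mul]
    positivity
  · rw [e]; nlinarith
  · rw [e]; nlinarith

theorem isCompact_truncSet {d : ℕ} (t : ℝ) : IsCompact (truncSet d t) := by
  refine Metric.isCompact_of_isClosed_isBounded ?_ ?_
  · refine IsClosed.inter (s₁ := {x : Space d | ∀ i, 0 ≤ x i}) ?_ (IsClosed.inter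
      (s₁ := {x : Space d | t ≤ coordSum d x}) (s₂ := {x : Space d | coordSum d x ≤ 1}) ?_ ?_)
    · have : {x : Space d | ∀ i, 0 ≤ x i} = ⋂ i, {x : Space d | 0 ≤ x i} := by ext; simp
      rw [this]
      exact isClosed_iInter fun i => isClosed_le continuous_const (by fun_prop)
    · exact isClosed_le continuous_const (coordSum d).continuous
    · exact isClosed_le (coordSum d).continuous continuous_const
  · refine (Metric.isBounded_closedBall (x := (0 : Space d)) (r := 1)).subset ?_
    rintro x ⟨h1, -, h3⟩
    rw [mem_closedBall_zero_iff, ← sq_le_one_iff₀ (norm_nonneg x), EuclideanSpace.real_norm_sq_eq]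
    rw [coordSum_apply] at h3
    refine le_trans (Finset.sum_le_sum fun i _ => ?_) h3
    have : x i ≤ 1 := (Finset.single_le_sum (f := fun i => x i) (fun i _ => h1 i)
      (Finset.mem_univ i)).trans h3
    nlinarith [h1 i]

theorem strict_subset_interior_truncSet {d : ℕ} (t : ℝ) :
    {x : Space d | (∀ i, 0 < x i) ∧ t < coordSum d x ∧ coordSum d x < 1} ⊆
      interior (truncSet d t) := by
  refine interior_maximal (fun x ⟨h1, h2, h3⟩ => ⟨fun i => (h1 i).le, h2.le, h3.le⟩) ?_
  refine IsOpen.inter (s := {x : Space d | ∀ i, 0 < x i}) ?_ (IsOpen.inter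
    (s := {x : Space d | t < coordSum d x}) (t := {x : Space d | coordSum d x < 1}) ?_ ?_)
  · have : {x : Space d | ∀ i, 0 < x i} = ⋂ i, {x : Space d | 0 < x i} := by ext; simp
    rw [this]
    exact isOpen_iInter_of_finite fun i => isOpen_lt continuous_const (by fun_prop)
  · exact isOpen_lt continuous_const (coordSum d).continuous
  · exact isOpen_lt (coordSum d).continuous continuous_const

theorem nonempty_interior_truncSet {d : ℕ} [NeZero d] {t : ℝ} (ht : t < 1) :
    (interior (truncSet d t)).Nonempty := by
  have hd : (0 : ℝ) < d := by exact_mod_cast NeZero.pos d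
  obtain ⟨q, hq, hq'⟩ := exists_between (max_lt ht one_pos)
  refine ⟨diag d (q / d), strict_subset_interior_truncSet t ⟨fun i => ?_, ?_, ?_⟩⟩
  · exact div_pos ((le_max_right _ _).trans_lt hq) hd
  · rw [coordSum_diag, mul_div_cancel₀ _ hd.ne']
    exact (le_max_left _ _).trans_lt hq
  · rwa [coordSum_diag, mul_div_cancel₀ _ hd.ne']

/-- The corner simplex `{x ≥ 0, ∑ xᵢ ≤ 1}`, truncated at its apex `0` by `t ≤ ∑ xᵢ` (for
`t ≤ 1/4`). -/
def truncSimplex (d : ℕ) [NeZero d] (t : ℝ) : Body d :=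
  -- The cap makes the family defined and Lipschitz for all real t. The value 1/4 lies below (d -
  -- 1)/(d + 1) for d ≥ 2, which later keeps an inscribed ellipsoid inside every member.
  ⟨{ carrier := truncSet d (min t (1 / 4))
     convex' := convex_truncSet _
     isCompact' := isCompact_truncSet _
     nonempty' := (nonempty_interior_truncSet (by
      exact (min_le_right _ _).trans_lt (by norm_num))).mono interior_subset },
    nonempty_interior_truncSet ((min_le_right _ _).trans_lt (by norm_num))⟩

theorem truncSimplex_toSet {d : ℕ} [NeZero d] {t : ℝ} (ht : t ≤ 1 / 4) :
    (truncSimplex d t).toSet = truncSet d t := by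
  change truncSet d (min t (1 / 4)) = _
  rw [min_eq_left ht]

theorem truncSimplex_map_permCoord {d : ℕ} [NeZero d] (t : ℝ) (e : Equiv.Perm (Fin d)) :
    (truncSimplex d t).map (permCoord d e) = truncSimplex d t := by
  refine Body.map_eq_of_forall_mem_iff _ fun x => ?_
  change permCoord d e x ∈ truncSet d _ ↔ x ∈ truncSet d _
  simp only [truncSet, Set.mem_ofPred_eq, coordSum_permCoord, permCoord_apply]
  refine and_congr_left fun _ => ⟨fun h i => ?_, fun h i => h _⟩
  simpa using h (e i)

/-- In barycentric coordinates, with x₀ = 1 - ∑ xⱼ at the apex, the map transposes x₀ and xᵢ. -/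
theorem truncSimplex_zero_map_swapApex {d : ℕ} [NeZero d] (i : Fin d) :
    (truncSimplex d 0).map (swapApex d i) = truncSimplex d 0 := by
  refine Body.map_eq_of_forall_mem_iff _ fun x => ?_
  rw [truncSimplex_toSet (by norm_num)]
  simp only [truncSet, Set.mem_ofPred_eq, coordSum_swapApex]
  have key (y : Space d) (h : ∀ i, 0 ≤ y i) : 0 ≤ coordSum d y ∧ y i ≤ coordSum d y := by
    rw [coordSum_apply]
    exact ⟨Finset.sum_nonneg fun i _ => h i,
      Finset.single_le_sum (f := fun i => y i) (fun i _ => h i) (Finset.mem_univ i)⟩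
  constructor
  · rintro ⟨h1, h2, h3⟩
    have hi := h1 i
    rw [swapApex_apply_self] at hi
    have h (j) : 0 ≤ x j := by
      by_cases hj : j = i
      · subst hj; linarith
      · simpa [swapApex_apply_of_ne hj] using h1 j
    exact ⟨h, (key x h).1, by linarith⟩
  · rintro ⟨h1, h2, h3⟩
    refine ⟨fun j => ?_, ?_, ?_⟩
    · by_cases hj : j = i
      · subst hj; rw [swapApex_apply_self]; linarith
      · simpa [swapApex_apply_of_ne hj] using h1 j
    · have := (key x h1).2
      linarith
    · have := h1 i
      linarith

/-- By symmetry an affine point of a truncated simplex lies on the diagonal. -/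
theorem AffinePoint.truncSimplex_apply {d : ℕ} [NeZero d] (p : AffinePoint d) (t : ℝ) (i : Fin d) :
    p (truncSimplex d t) i = coordSum d (p (truncSimplex d t)) / d := by
  have h (j : Fin d) : p (truncSimplex d t) j = p (truncSimplex d t) i := by
    have := p.map_map' (permCoord d (Equiv.swap i j)) (truncSimplex d t)
    rw [truncSimplex_map_permCoord] at this
    conv_lhs => rw [this]
    rw [permCoord_apply]
    simp
  have hd : (d : ℝ) ≠ 0 := NeZero.ne _
  rw [coordSum_apply, Finset.sum_congr rfl fun j _ => h j]
  simp
  field_simp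

/-- The symmetries of the full simplex make all d + 1 barycentric coordinates equal, so every affine
point is the centroid there. -/
theorem AffinePoint.coordSum_truncSimplex_zero {d : ℕ} [NeZero d] (p : AffinePoint d) :
    coordSum d (p (truncSimplex d 0)) = d / (d + 1) := by
  have := p.map_map' (swapApex d 0) (truncSimplex d 0)
  rw [truncSimplex_zero_map_swapApex] at this
  have h := congrArg (fun x => x 0) this
  simp only [swapApex_apply_self] at h
  rw [p.truncSimplex_apply] at h
  have hd : (d : ℝ) ≠ 0 := NeZero.ne _
  have hd' : (d : ℝ) + 1 ≠ 0 := by positivity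
  field_simp at h ⊢
  linarith

/-- The truncated simplex depends continuously on the truncation. -/
theorem continuous_truncSimplex (d : ℕ) [NeZero d] : Continuous (truncSimplex d) := by
  have hd : (0 : ℝ) < d := by exact_mod_cast NeZero.pos d
  have key (s t : ℝ) : ∀ x ∈ (truncSimplex d s).toSet,
      ∃ y ∈ (truncSimplex d t).toSet, dist x y ≤ ‖diag d (1 / d)‖ * dist s t := by
    rintro x ⟨h1, h2, h3⟩
    by_cases hx : min t (1 / 4) ≤ coordSum d x
    · exact ⟨x, ⟨h1, hx, h3⟩, by rw [dist_self]; positivity⟩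
    · push Not at hx
      -- A point that is cut off moves along the diagonal until its coordinate sum reaches the
      -- truncation level.
      refine ⟨x + (min t (1 / 4) - coordSum d x) • diag d (1 / d), ⟨fun i => ?_, ?_, ?_⟩, ?_⟩
      · have : 0 ≤ (min t (1 / 4) - coordSum d x) * (1 / d) :=
          mul_nonneg (by linarith) (by positivity)
        simpa using add_nonneg (h1 i) this
      · simp only [map_add, map_smul, coordSum_diag, smul_eq_mul]
        rw [mul_one_div_cancel hd.ne']
        linarith
      · simp only [map_add, map_smul, coordSum_diag, smul_eq_mul]
        rw [mul_one_div_cancel hd.ne']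
        linarith [min_le_right t (1 / 4)]
      · rw [dist_self_add_right, norm_smul, mul_comm, Real.norm_of_nonneg (by linarith)]
        gcongr
        rw [Real.dist_eq]
        have h4 : |min s (1/4) - min t (1/4)| ≤ |s - t| := by
          simpa using abs_min_sub_min_le_max s (1/4) t (1/4)
        have h5 := neg_le_abs (min s (1/4) - min t (1/4))
        linarith
  refine (LipschitzWith.of_dist_le_mul (K := ‖diag d (1 / d)‖₊) fun s t => ?_).continuous
  change Metric.hausdorffDist (truncSimplex d s).toSet (truncSimplex d t).toSet ≤ _
  rw [coe_nnnorm]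
  refine Metric.hausdorffDist_le_of_mem_dist (by positivity) (key s t) ?_
  rw [dist_comm s t]
  exact key t s

/-- The interior of a truncated simplex contains the points with strict inequalities. -/
theorem diag_mem_interior_truncSimplex {d : ℕ} [NeZero d] {t q : ℝ} (ht : 0 ≤ t) (ht' : t ≤ 1 / 4)
    (hq : t < q) (hq' : q < 1) : diag d (q / d) ∈ interior (truncSimplex d t).toSet := by
  have hd : (0 : ℝ) < d := by exact_mod_cast NeZero.pos d
  rw [truncSimplex_toSet ht']
  refine strict_subset_interior_truncSet t ⟨fun i => ?_, ?_, ?_⟩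
  · simp only [diag_apply]
    exact div_pos (by linarith) hd
  · rwa [coordSum_diag, mul_div_cancel₀ _ hd.ne']
  · rwa [coordSum_diag, mul_div_cancel₀ _ hd.ne']

/-! ### Continuity of integrals over convex bodies -/

theorem Body.hausdorffEDist_ne_top {d : ℕ} (C C' : Body d) :
    Metric.hausdorffEDist C.toSet C'.toSet ≠ ⊤ :=
  Metric.hausdorffEDist_ne_top_of_nonempty_of_bounded C.1.nonempty C'.1.nonempty
    C.1.isCompact.isBounded C'.1.isCompact.isBounded

theorem continuous_infDist_body (d : ℕ) :
    Continuous fun z : Body d × Space d => Metric.infDist z.2 z.1.toSet := by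
  refine (LipschitzWith.of_dist_le_mul (K := 2) fun z w => ?_).continuous
  have h1 : Metric.infDist z.2 z.1.toSet ≤ Metric.infDist w.2 w.1.toSet + 2 * dist z w := by
    have a := Metric.infDist_le_infDist_add_dist (s := z.1.toSet) (x := z.2) (y := w.2)
    have b := Metric.infDist_le_infDist_add_hausdorffDist (x := w.2)
      (w.1.hausdorffEDist_ne_top z.1)
    have c : Metric.hausdorffDist w.1.toSet z.1.toSet = dist z.1 w.1 := dist_comm w.1 z.1
    have e : dist z.1 w.1 ≤ dist z w := le_max_left _ _
    have f : dist z.2 w.2 ≤ dist z w := le_max_right _ _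
    linarith
  have h2 : Metric.infDist w.2 w.1.toSet ≤ Metric.infDist z.2 z.1.toSet + 2 * dist z w := by
    have a := Metric.infDist_le_infDist_add_dist (s := w.1.toSet) (x := w.2) (y := z.2)
    have b := Metric.infDist_le_infDist_add_hausdorffDist (x := z.2)
      (z.1.hausdorffEDist_ne_top w.1)
    have c : Metric.hausdorffDist z.1.toSet w.1.toSet = dist z.1 w.1 := rfl
    have e : dist z.1 w.1 ≤ dist z w := le_max_left _ _
    have f : dist z.2 w.2 ≤ dist z w := le_max_right _ _
    rw [dist_comm] at a
    linarith
  rw [Real.dist_eq, abs_le]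
  norm_num
  constructor <;> linarith

theorem Body.mem_iff_infDist {d : ℕ} (C : Body d) (x : Space d) :
    x ∈ C.toSet ↔ Metric.infDist x C.toSet = 0 :=
  C.1.isCompact.isClosed.mem_iff_infDist_zero C.1.nonempty

theorem isClosed_mem_body (d : ℕ) :
    IsClosed {z : Body d × Space d | z.2 ∈ z.1.toSet} := by
  simp_rw [Body.mem_iff_infDist]
  exact isClosed_eq (continuous_infDist_body d) continuous_const

/-- If a convex body contains a ball, then all convex bodies at small Hausdorff distance contain
a slightly smaller concentric ball. -/
theorem Body.mem_of_dist_lt {d : ℕ} {C C' : Body d} {x : Space d} {r : ℝ}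
    (h : Metric.closedBall x r ⊆ C.toSet) (hr : 0 < r) (hC : dist C C' < r) : x ∈ C'.toSet := by
  by_contra hx
  -- Moving from `x` by `r` along the normal of a separating hyperplane stays in `C` but reaches
  -- distance at least `r` from `C'`.
  obtain ⟨f, u, hf, hu⟩ := geometric_hahn_banach_closed_point C'.1.convex
    C'.1.isCompact.isClosed hx
  set v := (InnerProductSpace.toDual ℝ (Space d)).symm f with hv
  have hfv (y : Space d) : f y = ⟪v, y⟫ := by simp [hv]
  have hv0 : 0 < ‖v‖ := by
    rw [norm_pos_iff]
    intro h0
    obtain ⟨y, hy⟩ := C'.1.nonempty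
    have := hf y hy
    simp only [hfv, h0, inner_zero_left] at this hu
    linarith
  have hmem : x + (r / ‖v‖) • v ∈ C.toSet := by
    refine h ?_
    rw [Metric.mem_closedBall, dist_self_add_left, norm_smul, Real.norm_of_nonneg (by positivity),
      div_mul_cancel₀ _ hv0.ne']
  obtain ⟨y, hy, hxy⟩ := Metric.exists_dist_lt_of_hausdorffDist_lt hmem hC
    (C.hausdorffEDist_ne_top C')
  have h1 := hf y hy
  rw [hfv] at h1 hu
  have h2 : ⟪v, x + (r / ‖v‖) • v - y⟫ ≤ ‖v‖ * r := by
    refine (real_inner_le_norm _ _).trans ?_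
    rw [dist_eq_norm] at hxy
    gcongr
  rw [inner_sub_right, inner_add_right, real_inner_smul_right, real_inner_self_eq_norm_sq] at h2
  have h3 : r / ‖v‖ * ‖v‖ ^ 2 = ‖v‖ * r := by field_simp
  linarith

theorem eventually_mem_body {d : ℕ} {C : Body d} {x : Space d} (hx : x ∈ interior C.toSet) :
    ∀ᶠ z : Body d × Space d in 𝓝 (C, x), z.2 ∈ z.1.toSet := by
  obtain ⟨r, hr, hball⟩ := Metric.isOpen_iff.1 isOpen_interior x hx
  rw [nhds_prod_eq]
  filter_upwards [prod_mem_prod (Metric.ball_mem_nhds C (show 0 < r / 4 by positivity))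
    (Metric.ball_mem_nhds x (show 0 < r / 4 by positivity))]
  rintro ⟨C', y⟩ ⟨h1, h2⟩
  refine Body.mem_of_dist_lt (C := C) (r := r / 2) ?_ (by positivity) ?_
  · refine subset_trans (fun w hw => hball ?_) interior_subset
    rw [Metric.mem_closedBall] at hw
    rw [Metric.mem_ball] at h2 ⊢
    linarith [dist_triangle w y x]
  · rw [Metric.mem_ball, dist_comm] at h1
    linarith

/-- Membership is locally constant away from the frontier. -/
theorem eventually_mem_body_iff {d : ℕ} {C : Body d} {x : Space d} (hx : x ∉ frontier C.toSet) :
    ∀ᶠ z : Body d × Space d in 𝓝 (C, x), (z.2 ∈ z.1.toSet ↔ x ∈ C.toSet) := by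
  by_cases h : x ∈ C.toSet
  · have hi : x ∈ interior C.toSet := by
      by_contra h'
      exact hx ⟨subset_closure h, h'⟩
    filter_upwards [eventually_mem_body hi] with z hz
    exact iff_of_true hz h
  · filter_upwards [(isClosed_mem_body d).isOpen_compl.mem_nhds (x := (C, x)) h] with z hz
    exact iff_of_false hz h

/-- Bodies near `C` lie in a common ball. -/
theorem eventually_body_subset_closedBall {d : ℕ} (C : Body d) :
    ∃ R, ∀ᶠ C' in 𝓝 C, C'.toSet ⊆ Metric.closedBall (0 : Space d) R := by
  obtain ⟨R, hR⟩ := C.1.isCompact.isBounded.subset_closedBall 0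
  refine ⟨R + 1, ?_⟩
  filter_upwards [Metric.ball_mem_nhds C one_pos] with C' hC' x hx
  obtain ⟨y, hy, hxy⟩ := Metric.exists_dist_lt_of_hausdorffDist_lt hx hC'
    (C'.hausdorffEDist_ne_top C)
  have := hR hy
  rw [Metric.mem_closedBall] at this ⊢
  linarith [dist_triangle x y 0]

theorem Body.measurableSet {d : ℕ} (C : Body d) : MeasurableSet C.toSet :=
  C.1.isCompact.isClosed.measurableSet

/-- The integral of a continuous function over `C ∩ (φ C)⁻¹ C` depends continuously on the convex
body `C` if the affine bijection `φ C` does. -/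
theorem continuous_setIntegral_inter_preimage {d : ℕ} {E : Type*} [NormedAddCommGroup E]
    [NormedSpace ℝ E] (F : Space d → E) (hF : Continuous F)
    (φ : Body d → Space d ≃ᵃ[ℝ] Space d) (hφ : ∀ x, Continuous fun C => φ C x) :
    Continuous fun C : Body d => ∫ x in C.toSet ∩ φ C ⁻¹' C.toSet, F x := by
  have hmeas (C : Body d) : MeasurableSet (C.toSet ∩ φ C ⁻¹' C.toSet) :=
    C.measurableSet.inter
      ((φ C).toAffineMap.continuous_of_finiteDimensional.measurable C.measurableSet)
  simp_rw [fun C : Body d => (integral_indicator (μ := volume) (f := F) (hmeas C)).symm]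
  rw [continuous_iff_continuousAt]
  intro C
  obtain ⟨R, hR⟩ := eventually_body_subset_closedBall C
  refine continuousAt_of_dominated
    (bound := (Metric.closedBall (0 : Space d) R).indicator fun x => ‖F x‖) ?_ ?_ ?_ ?_
  · exact Eventually.of_forall fun C' =>
      hF.aestronglyMeasurable.indicator (hmeas C')
  · filter_upwards [hR] with C' hC'
    refine Eventually.of_forall fun x => ?_
    rw [norm_indicator_eq_indicator_norm]
    exact Set.indicator_le_indicator_of_subset (fun y hy => hC' hy.1) (fun _ => norm_nonneg _) x
  · rw [integrable_indicator_iff Metric.isClosed_closedBall.measurableSet]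
    exact hF.norm.continuousOn.integrableOn_compact (isCompact_closedBall 0 R)
  -- The indicators converge at every point off the two frontiers, which are null sets by convexity.
  · have h1 : ∀ᵐ x : Space d, x ∉ frontier C.toSet :=
      measure_eq_zero_iff_ae_notMem.1 (C.1.convex.addHaar_frontier volume)
    have h2 : ∀ᵐ x : Space d, x ∉ φ C ⁻¹' frontier C.toSet := by
      refine measure_eq_zero_iff_ae_notMem.1 ?_
      have := (AffineEquiv.toContinuousAffineEquiv (φ C)).toHomeomorph.preimage_frontier C.toSet
      change φ C ⁻¹' frontier C.toSet = frontier (φ C ⁻¹' C.toSet) at this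
      rw [this]
      exact (C.1.convex.affine_preimage (φ C).toAffineMap).addHaar_frontier volume
    filter_upwards [h1, h2] with x hx1 hx2
    have e1 : Tendsto (fun C' : Body d => (C', x)) (𝓝 C) (𝓝 (C, x)) :=
      (Continuous.prodMk_left x).tendsto C
    have e2 : Tendsto (fun C' : Body d => (C', φ C' x)) (𝓝 C) (𝓝 (C, φ C x)) :=
      (continuous_id.prodMk (hφ x)).tendsto C
    refine tendsto_const_nhds.congr' ?_
    filter_upwards [e1.eventually (eventually_mem_body_iff hx1),
      e2.eventually (eventually_mem_body_iff hx2)] with C' h h'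
    have : x ∈ C'.toSet ∩ φ C' ⁻¹' C'.toSet ↔ x ∈ C.toSet ∩ φ C ⁻¹' C.toSet := and_congr h h'
    by_cases hx : x ∈ C.toSet ∩ φ C ⁻¹' C.toSet
    · rw [Set.indicator_of_mem hx, Set.indicator_of_mem (this.2 hx)]
    · rw [Set.indicator_of_notMem hx, Set.indicator_of_notMem (fun h => hx (this.1 h))]

theorem continuous_setIntegral_body {d : ℕ} {E : Type*} [NormedAddCommGroup E]
    [NormedSpace ℝ E] (F : Space d → E) (hF : Continuous F) :
    Continuous fun C : Body d => ∫ x in C.toSet, F x := by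
  have := continuous_setIntegral_inter_preimage F hF (fun _ => AffineEquiv.refl ℝ _)
    fun x => continuous_const
  simpa using this

/-! ### Affine changes of variables -/

/-- An affine bijection scales Lebesgue measure by a positive constant. -/
theorem exists_integral_comp_affineEquiv {d : ℕ} (T : Space d ≃ᵃ[ℝ] Space d) :
    ∃ c : ℝ, 0 < c ∧ ∀ (E : Type) [NormedAddCommGroup E] [NormedSpace ℝ E] (f : Space d → E),
      ∫ x, f x = c • ∫ x, f (T x) := by
  set L := T.linear with hL
  have hdet : LinearMap.det (L : Space d →ₗ[ℝ] Space d) ≠ 0 := (LinearEquiv.isUnit_det' L).ne_zero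
  refine ⟨|LinearMap.det (L : Space d →ₗ[ℝ] Space d)|, abs_pos.2 hdet, fun E _ _ f => ?_⟩
  have hT (x : Space d) : T x = L x + T 0 := by
    have := T.map_vadd 0 x
    simpa using this
  have h1 : ∫ x, f (T x) = ∫ x, f (L x + T 0) :=
    integral_congr_ae (Filter.Eventually.of_forall fun x => congrArg f (hT x))
  have h2 : ∫ x, f (L x + T 0) = ∫ y, f (y + T 0) ∂(Measure.map L volume) := by
    have := L.toContinuousLinearEquiv.toHomeomorph.toMeasurableEquiv.measurableEmbedding.integral_map
      (μ := volume) (fun y => f (y + T 0))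
    exact this.symm
  have h3 : Measure.map L (volume : Measure (Space d)) =
      ENNReal.ofReal |(LinearMap.det (L : Space d →ₗ[ℝ] Space d))⁻¹| • volume :=
    Measure.map_linearMap_addHaar_eq_smul_addHaar volume hdet
  rw [h1, h2, h3, integral_smul_measure, integral_add_right_eq_self, smul_smul,
    ENNReal.toReal_ofReal (abs_nonneg _), ← abs_mul, mul_inv_cancel₀ hdet, abs_one, one_smul]

/-- The factor `c` is chosen before `E` and `f`, so that it cancels between scalar and vector
integrals. -/
theorem exists_setIntegral_comp_affineEquiv {d : ℕ} (T : Space d ≃ᵃ[ℝ] Space d) :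
    ∃ c : ℝ, 0 < c ∧ ∀ (E : Type) [NormedAddCommGroup E] [NormedSpace ℝ E] (f : Space d → E)
      (S : Set (Space d)), MeasurableSet S → ∫ x in S, f x = c • ∫ x in T ⁻¹' S, f (T x) := by
  obtain ⟨c, hc, h⟩ := exists_integral_comp_affineEquiv T
  refine ⟨c, hc, fun E _ _ f S hS => ?_⟩
  have hS' : MeasurableSet (T ⁻¹' S) :=
    T.toAffineMap.continuous_of_finiteDimensional.measurable hS
  rw [← integral_indicator hS, ← integral_indicator hS', h]
  rfl

/-! ### The centroid and a perturbation field -/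

theorem Body.integrableOn {d : ℕ} {E : Type*} [NormedAddCommGroup E] (C : Body d)
    {F : Space d → E} (hF : Continuous F) : IntegrableOn F C.toSet :=
  hF.continuousOn.integrableOn_compact C.1.isCompact

/-- The volume of a convex body. -/
noncomputable def Body.vol {d : ℕ} (C : Body d) : ℝ := ∫ _ in C.toSet, (1 : ℝ)

theorem Body.vol_pos {d : ℕ} (C : Body d) : 0 < C.vol := by
  rw [Body.vol, setIntegral_const, smul_eq_mul, mul_one, measureReal_def]
  refine ENNReal.toReal_pos ?_ C.1.isCompact.measure_lt_top.ne
  exact (Measure.measure_pos_of_nonempty_interior volume C.2).ne'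

theorem Body.preimage_map {d : ℕ} (T : Space d ≃ᵃ[ℝ] Space d) (C : Body d) :
    T ⁻¹' (C.map T).toSet = C.toSet :=
  Set.ext fun x => C.mem_map_iff T x

/-- The centroid of a convex body. -/
noncomputable def centroid {d : ℕ} (C : Body d) : Space d := C.vol⁻¹ • ∫ x in C.toSet, x

theorem continuous_vol (d : ℕ) : Continuous (Body.vol (d := d)) :=
  continuous_setIntegral_body _ continuous_const

theorem continuous_centroid (d : ℕ) : Continuous (centroid (d := d)) :=
  ((continuous_vol d).inv₀ fun C => C.vol_pos.ne').smul
    (continuous_setIntegral_body _ continuous_id)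

theorem affineEquiv_apply {d : ℕ} (T : Space d ≃ᵃ[ℝ] Space d) (x : Space d) :
    T x = T.linear x + T 0 := by
  simpa using T.map_vadd 0 x

theorem setIntegral_affineEquiv {d : ℕ} (T : Space d ≃ᵃ[ℝ] Space d) {S : Set (Space d)}
    (hS : IntegrableOn (fun x : Space d => x) S) (hS' : IntegrableOn (fun _ => (1 : ℝ)) S) :
    ∫ x in S, T x = T.linear (∫ x in S, x) + (∫ _ in S, (1 : ℝ)) • T 0 := by
  have e : ∀ x, T x = T.linear.toLinearMap.toContinuousLinearMap x + (1 : ℝ) • T 0 := fun x => by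
    rw [one_smul]; exact affineEquiv_apply T x
  rw [integral_congr_ae (Eventually.of_forall e), integral_add, integral_smul_const,
    ContinuousLinearMap.integral_comp_comm _ hS]
  · rfl
  · exact ContinuousLinearMap.integrable_comp _ hS
  · exact hS'.smul_const _

theorem centroid_map {d : ℕ} (T : Space d ≃ᵃ[ℝ] Space d) (C : Body d) :
    centroid (C.map T) = T (centroid C) := by
  obtain ⟨c, hc, h⟩ := exists_setIntegral_comp_affineEquiv T
  have h1 : (C.map T).vol = c * C.vol := by
    rw [Body.vol, h ℝ (fun _ => 1) _ (C.map T).measurableSet, Body.preimage_map]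
    rfl
  have h2 : ∫ x in (C.map T).toSet, x = c • ∫ x in C.toSet, T x := by
    rw [h (Space d) (fun x => x) _ (C.map T).measurableSet, Body.preimage_map]
  rw [centroid, h1, h2, setIntegral_affineEquiv T (C.integrableOn continuous_id)
    (C.integrableOn continuous_const), affineEquiv_apply T (centroid C), centroid, map_smul,
    smul_smul, smul_add, smul_smul, ← Body.vol, mul_inv, mul_right_comm, inv_mul_cancel₀ hc.ne',
    one_mul, inv_mul_cancel₀ C.vol_pos.ne', one_smul]

/-- The centroid as an affine point. -/
noncomputable def centroidPoint (d : ℕ) : AffinePoint d :=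
  ⟨centroid, continuous_centroid d, centroid_map⟩

/-- The homothety `x ↦ z - κ (x - z)` with centre `z` and ratio `-κ`. -/
noncomputable def antiHomothety {d : ℕ} (κ : ℝ) (hκ : κ ≠ 0) (z : Space d) :
    Space d ≃ᵃ[ℝ] Space d :=
  (LinearEquiv.smulOfNeZero ℝ (Space d) (-κ) (neg_ne_zero.2 hκ)).toAffineEquiv.trans
    (AffineEquiv.constVAdd ℝ _ ((1 + κ) • z))

theorem antiHomothety_apply {d : ℕ} (κ : ℝ) (hκ : κ ≠ 0) (z x : Space d) :
    antiHomothety κ hκ z x = z - κ • (x - z) := by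
  change (1 + κ) • z + (-κ) • x = _
  module

/-- The part of `C` whose image under the homothety of ratio `-κ` at the centroid stays
in `C`. -/
def Body.core {d : ℕ} (κ : ℝ) (hκ : κ ≠ 0) (C : Body d) : Set (Space d) :=
  C.toSet ∩ antiHomothety κ hκ (centroid C) ⁻¹' C.toSet

/-! ### The core of a body: an invariant ratio and an equivariant moment -/

section Core

variable {d : ℕ} {κ : ℝ} (hκ : κ ≠ 0)

theorem Body.mem_core {C : Body d} {x : Space d} :
    x ∈ C.core κ hκ ↔ x ∈ C.toSet ∧ centroid C - κ • (x - centroid C) ∈ C.toSet := by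
  rw [← antiHomothety_apply κ hκ]
  rfl

theorem Body.isClosed_core (C : Body d) : IsClosed (C.core κ hκ) :=
  C.1.isCompact.isClosed.inter (C.1.isCompact.isClosed.preimage
    (antiHomothety κ hκ (centroid C)).toAffineMap.continuous_of_finiteDimensional)

theorem Body.integrableOn_core {E : Type*} [NormedAddCommGroup E] (C : Body d)
    {F : Space d → E} (hF : Continuous F) : IntegrableOn F (C.core κ hκ) :=
  (C.integrableOn hF).mono_set Set.inter_subset_left

/-- Affine maps preserve centroids and conjugate homotheties into homotheties of the same ratio. -/
theorem Body.preimage_core_map (T : Space d ≃ᵃ[ℝ] Space d) (C : Body d) :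
    T ⁻¹' (C.map T).core κ hκ = C.core κ hκ := by
  ext x
  have e : T (centroid C) - κ • (T x - T (centroid C)) =
      T (centroid C - κ • (x - centroid C)) := by
    simp only [affineEquiv_apply T (centroid C), affineEquiv_apply T x,
      affineEquiv_apply T (centroid C - κ • (x - centroid C)), map_sub, map_smul]
    module
  rw [Set.mem_preimage, Body.mem_core, Body.mem_core, centroid_map, e, Body.mem_map_iff,
    Body.mem_map_iff]

theorem continuous_antiHomothety_centroid (x : Space d) :
    Continuous fun C : Body d => antiHomothety κ hκ (centroid C) x := by
  simp_rw [antiHomothety_apply]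
  exact (continuous_centroid d).sub ((continuous_const.sub (continuous_centroid d)).const_smul κ)

/-- The proportion of the volume of `C` that lies in its core. -/
noncomputable def coreRatio (C : Body d) : ℝ := C.vol⁻¹ * ∫ _ in C.core κ hκ, (1 : ℝ)

/-- The first moment of the core of `C` with respect to the centroid of `C`. -/
noncomputable def coreMoment (C : Body d) : Space d :=
  C.vol⁻¹ • ((∫ x in C.core κ hκ, x) - (∫ _ in C.core κ hκ, (1 : ℝ)) • centroid C)

theorem continuous_coreRatio : Continuous (coreRatio (d := d) hκ) :=
  ((continuous_vol d).inv₀ fun C => C.vol_pos.ne').mul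
    (continuous_setIntegral_inter_preimage _ continuous_const _
      (continuous_antiHomothety_centroid hκ))

theorem continuous_coreMoment : Continuous (coreMoment (d := d) hκ) := by
  have h1 : Continuous fun C : Body d => ∫ x in C.core κ hκ, x :=
    continuous_setIntegral_inter_preimage _ continuous_id _ (continuous_antiHomothety_centroid hκ)
  have h2 : Continuous fun C : Body d => ∫ _ in C.core κ hκ, (1 : ℝ) :=
    continuous_setIntegral_inter_preimage _ continuous_const _
      (continuous_antiHomothety_centroid hκ)
  exact ((continuous_vol d).inv₀ fun C => C.vol_pos.ne').smul
    (h1.sub (h2.smul (continuous_centroid d)))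

theorem coreRatio_map (T : Space d ≃ᵃ[ℝ] Space d) (C : Body d) :
    coreRatio hκ (C.map T) = coreRatio hκ C := by
  obtain ⟨c, hc, h⟩ := exists_setIntegral_comp_affineEquiv T
  rw [coreRatio, Body.vol, h ℝ (fun _ => 1) _ (C.map T).measurableSet, Body.preimage_map,
    h ℝ (fun _ => 1) _ ((C.map T).isClosed_core hκ).measurableSet, Body.preimage_core_map,
    coreRatio, Body.vol, smul_eq_mul, smul_eq_mul, mul_inv, mul_mul_mul_comm,
    inv_mul_cancel₀ hc.ne', one_mul]

/-- Because the moment is taken about the centroid, the translation part of `T` cancels and only the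
linear part acts. -/
theorem coreMoment_map (T : Space d ≃ᵃ[ℝ] Space d) (C : Body d) :
    coreMoment hκ (C.map T) = T.linear (coreMoment hκ C) := by
  obtain ⟨c, hc, h⟩ := exists_setIntegral_comp_affineEquiv T
  rw [coreMoment, Body.vol, h ℝ (fun _ => 1) _ (C.map T).measurableSet, Body.preimage_map,
    h ℝ (fun _ => 1) _ ((C.map T).isClosed_core hκ).measurableSet, Body.preimage_core_map,
    h (Space d) (fun x => x) _ ((C.map T).isClosed_core hκ).measurableSet, Body.preimage_core_map,
    setIntegral_affineEquiv T (C.integrableOn_core hκ continuous_id)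
      (C.integrableOn_core hκ continuous_const), centroid_map, affineEquiv_apply T (centroid C),
    coreMoment, ← Body.vol, map_smul, map_sub, map_smul, smul_eq_mul, smul_eq_mul]
  have : (c * C.vol)⁻¹ * c = C.vol⁻¹ := by
    rw [mul_inv, mul_right_comm, inv_mul_cancel₀ hc.ne', one_mul]
  rw [← this]
  module

theorem coreMoment_eq (C : Body d) :
    coreMoment hκ C = C.vol⁻¹ • ∫ x in C.core κ hκ, (x - centroid C) := by
  rw [coreMoment, integral_sub (C.integrableOn_core (F := fun x => x) hκ continuous_id)
    (C.integrableOn_core hκ continuous_const)]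
  congr 2
  rw [setIntegral_const, setIntegral_const, smul_eq_mul, mul_one]

/-- The perturbation of an affine point in the direction of the moment of the core. -/
noncomputable def AffinePoint.perturb (p : AffinePoint d) (ε : ℝ) (ψ : ℝ → ℝ)
    (hψ : Continuous ψ) : AffinePoint d where
  toFun C := p C - (ε * ψ (coreRatio hκ C)) • coreMoment hκ C
  continuous_toFun := p.continuous_toFun.sub
    (((hψ.comp (continuous_coreRatio hκ)).const_mul ε).smul (continuous_coreMoment hκ))
  map_map' T C := by
    rw [coreRatio_map, coreMoment_map, p.map_map', affineEquiv_apply T (p C),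
      affineEquiv_apply T (p C - _), map_sub, map_smul]
    abel

theorem AffinePoint.perturb_apply (p : AffinePoint d) (ε : ℝ) (ψ : ℝ → ℝ)
    (hψ : Continuous ψ) (C : Body d) :
    p.perturb hκ ε ψ hψ C = p C - (ε * ψ (coreRatio hκ C)) • coreMoment hκ C := rfl

/-- Small perturbations are close to the original point, uniformly in the profile `ψ`. -/
theorem AffinePoint.exists_dist_perturb_le (κ : ℝ) (hκ : κ ≠ 0) (p : AffinePoint d) :
    ∃ M : ℝ, ∀ (ε : ℝ) (ψ : ℝ → ℝ) (hψ : Continuous ψ), 0 ≤ ε → (∀ s, |ψ s| ≤ 1) →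
      dist (p.perturb hκ ε ψ hψ) p ≤ ε * M := by
  obtain ⟨M, hM⟩ := (isCompact_pinched d).exists_bound_of_continuousOn
    (continuous_coreMoment hκ).continuousOn
  refine ⟨max M 0, fun ε ψ hψ hε h1 => ?_⟩
  rw [dist_def]
  refine Real.iSup_le (fun C => ?_) (mul_nonneg hε (le_max_right _ _))
  rw [AffinePoint.perturb_apply, sub_sub_cancel_left, norm_neg, norm_smul, norm_mul,
    Real.norm_of_nonneg hε, mul_assoc]
  refine mul_le_mul_of_nonneg_left ?_ hε
  have a := h1 (coreRatio hκ C.1)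
  rw [← Real.norm_eq_abs] at a
  calc _ ≤ 1 * M := mul_le_mul a (hM C.1 C.2) (norm_nonneg _) zero_le_one
    _ ≤ max M 0 := by rw [one_mul]; exact le_max_left _ _

end Core

/-! ### Centroids of truncated simplices -/

open scoped Pointwise in
/-- Integrals of homogeneous functions over truncated simplices. -/
theorem setIntegral_truncSet {d : ℕ} (f : Space d → ℝ) (hf : Continuous f) (k : ℕ)
    (hk : ∀ c : ℝ, 0 < c → ∀ x, f (c • x) = c ^ k * f x) {t : ℝ} (ht : 0 < t) (ht' : t < 1) :
    ∫ x in truncSet d t, f x = (1 - t ^ (d + k)) * ∫ x in truncSet d 0, f x := by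
  set S := truncSet d 0 with hS
  have hmem (x : Space d) : x ∈ t • S ↔ (∀ i, 0 ≤ x i) ∧ coordSum d x ≤ t := by
    rw [Set.mem_smul_set_iff_inv_smul_mem₀ ht.ne']
    have hx : (∀ i, 0 ≤ x i) → 0 ≤ coordSum d x := fun h => by
      rw [coordSum_apply]; exact Finset.sum_nonneg fun i _ => h i
    have e : (∀ i, 0 ≤ (t⁻¹ • x) i) ↔ ∀ i, 0 ≤ x i := by
      refine forall_congr' fun i => ?_
      rw [PiLp.smul_apply, smul_eq_mul, mul_nonneg_iff_of_pos_left (inv_pos.2 ht)]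
    change ((∀ i, 0 ≤ (t⁻¹ • x) i) ∧ 0 ≤ coordSum d (t⁻¹ • x) ∧ coordSum d (t⁻¹ • x) ≤ 1) ↔ _
    rw [e, map_smul, smul_eq_mul, mul_nonneg_iff_of_pos_left (inv_pos.2 ht), inv_mul_le_one₀ ht]
    exact ⟨fun h => ⟨h.1, h.2.2⟩, fun h => ⟨h.1, hx h.1, h.2⟩⟩
  have hunion : S = truncSet d t ∪ t • S := by
    ext x
    have hx : (∀ i, 0 ≤ x i) → 0 ≤ coordSum d x := fun h => by
      rw [coordSum_apply]; exact Finset.sum_nonneg fun i _ => h i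
    rw [Set.mem_union, hmem]
    constructor
    · rintro ⟨h1, h2, h3⟩
      rcases le_total t (coordSum d x) with h | h
      · exact Or.inl ⟨h1, h, h3⟩
      · exact Or.inr ⟨h1, h⟩
    · rintro (⟨h1, h2, h3⟩ | ⟨h1, h2⟩)
      · exact ⟨h1, hx h1, h3⟩
      · exact ⟨h1, hx h1, by linarith⟩
  -- The pieces meet only where the coordinate sum is t. Such a point is on the frontier of the
  -- truncated piece, since shrinking it towards 0 leaves that piece.
  have hdisj : AEDisjoint volume (truncSet d t) (t • S) := by
    refine measure_mono_null ?_ ((convex_truncSet (d := d) t).addHaar_frontier volume)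
    rintro x ⟨hx, hx'⟩
    rw [hmem] at hx'
    refine ⟨subset_closure hx, fun hi => ?_⟩
    have hc : Tendsto (fun c : ℝ => c • x) (𝓝[<] 1) (𝓝 x) := by
      have : Continuous fun c : ℝ => c • x := by fun_prop
      simpa using (this.tendsto 1).mono_left nhdsWithin_le_nhds
    obtain ⟨c, hc1, hc2⟩ := ((hc.eventually (mem_interior_iff_mem_nhds.1 hi)).and
      self_mem_nhdsWithin).exists
    have h1 : t ≤ coordSum d (c • x) := hc1.2.1
    rw [map_smul, smul_eq_mul] at h1
    have h2 : c < 1 := hc2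
    nlinarith [hx.2.1]
  have hint (s : ℝ) : IntegrableOn f (truncSet d s) :=
    hf.continuousOn.integrableOn_compact (isCompact_truncSet s)
  have hsmul : ∫ x in t • S, f x = t ^ (d + k) * ∫ x in S, f x := by
    have h := Measure.setIntegral_comp_smul_of_pos volume f S ht
    simp_rw [hk t ht] at h
    rw [integral_const_mul, finrank_euclideanSpace_fin, smul_eq_mul] at h
    rw [pow_add, mul_assoc, h, mul_inv_cancel_left₀ (pow_ne_zero _ ht.ne')]
  have hcl : MeasurableSet (t • S) :=
    ((isCompact_truncSet 0).smul t).isClosed.measurableSet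
  have h := setIntegral_union₀ hdisj hcl.nullMeasurableSet (hint t)
    ((hint 0).mono_set (Set.subset_union_right.trans hunion.ge))
  rw [← hunion, hsmul] at h
  linarith

theorem coordSum_centroid (C : Body d) :
    coordSum d (centroid C) = C.vol⁻¹ * ∫ x in C.toSet, coordSum d x := by
  rw [centroid, map_smul, smul_eq_mul,
    ContinuousLinearMap.integral_comp_comm _ (C.integrableOn (F := fun x => x) continuous_id)]

section Centroid

variable {d : ℕ} [NeZero d]

/-- The sum of the coordinates of the centroid of a truncated simplex. -/
noncomputable def centroidSum (d : ℕ) [NeZero d] (t : ℝ) : ℝ :=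
  coordSum d (centroid (truncSimplex d t))

theorem continuous_centroidSum : Continuous (centroidSum d) :=
  (coordSum d).continuous.comp ((continuous_centroid d).comp (continuous_truncSimplex d))

theorem centroidSum_zero : centroidSum d 0 = d / (d + 1) :=
  (centroidPoint d).coordSum_truncSimplex_zero

theorem centroid_truncSimplex_apply (t : ℝ) (i : Fin d) :
    centroid (truncSimplex d t) i = centroidSum d t / d :=
  (centroidPoint d).truncSimplex_apply t i

/-- Removing the t-scaled simplex multiplies the volume by 1 - t^d and the integral of the
coordinate sum, homogeneous of degree 1, by 1 - t^(d+1). -/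
theorem centroidSum_eq {t : ℝ} (ht : 0 < t) (ht' : t ≤ 1 / 4) :
    centroidSum d t * (1 - t ^ d) = d / (d + 1) * (1 - t ^ (d + 1)) := by
  have ht1 : t < 1 := by linarith
  rw [← centroidSum_zero (d := d), centroidSum, centroidSum, coordSum_centroid, coordSum_centroid,
    Body.vol, Body.vol, truncSimplex_toSet ht', truncSimplex_toSet (show (0 : ℝ) ≤ 1 / 4 by norm_num),
    setIntegral_truncSet (coordSum d) (coordSum d).continuous 1 (fun c _ x => by simp) ht ht1,
    setIntegral_truncSet (fun _ => 1) continuous_const 0 (fun c _ x => by simp) ht ht1]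
  have h : (1 - t ^ d) ≠ 0 := (sub_pos.2 (pow_lt_one₀ ht.le ht1 (NeZero.ne d))).ne'
  rw [add_zero]
  field_simp

theorem centroidSum_lt {a b : ℝ} (ha : 0 < a) (hab : a < b) (hb : b ≤ 1 / 4) :
    centroidSum d a < centroidSum d b := by
  have hb0 : 0 < b := ha.trans hab
  have hA : 0 < 1 - a ^ d := sub_pos.2 (pow_lt_one₀ ha.le (by linarith) (NeZero.ne d))
  have hB : 0 < 1 - b ^ d := sub_pos.2 (pow_lt_one₀ hb0.le (by linarith) (NeZero.ne d))
  have hd : (0 : ℝ) < d / (d + 1) := by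
    have : (0 : ℝ) < d := by exact_mod_cast NeZero.pos d
    positivity
  -- Monotonicity of (1 - t^(d+1))/(1 - t^d) = 1 + t^d / ∑_{i<d} t^i; after cross-multiplication the
  -- sums compare term by term.
  have key : a ^ d * (1 - a) * (1 - b ^ d) < b ^ d * (1 - b) * (1 - a ^ d) := by
    have hsum : a ^ d * ∑ i ∈ Finset.range d, b ^ i < b ^ d * ∑ i ∈ Finset.range d, a ^ i := by
      rw [Finset.mul_sum, Finset.mul_sum]
      refine Finset.sum_lt_sum_of_nonempty (by simpa using NeZero.ne d) fun i hi => ?_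
      have hi' : i < d := Finset.mem_range.1 hi
      obtain ⟨k, rfl⟩ := Nat.exists_eq_add_of_lt hi'
      have h1 : a ^ (k + 1) < b ^ (k + 1) := pow_lt_pow_left₀ hab ha.le (by omega)
      have h2 : 0 < (a * b) ^ i := by positivity
      calc a ^ (i + k + 1) * b ^ i = (a * b) ^ i * a ^ (k + 1) := by ring
        _ < (a * b) ^ i * b ^ (k + 1) := by gcongr
        _ = b ^ (i + k + 1) * a ^ i := by ring
    have e1 := mul_neg_geom_sum a d
    have e2 := mul_neg_geom_sum b d
    rw [← e1, ← e2]
    have hp : 0 < (1 - a) * (1 - b) := mul_pos (by linarith) (by linarith)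
    nlinarith
  have hA' := centroidSum_eq (d := d) ha (by linarith)
  have hB' := centroidSum_eq (d := d) hb0 hb
  rw [← mul_lt_mul_iff_left₀ (mul_pos hA hB)]
  have e1 : centroidSum d a * ((1 - a ^ d) * (1 - b ^ d)) =
      d / (d + 1) * ((1 - a ^ (d + 1)) * (1 - b ^ d)) := by
    rw [← mul_assoc, hA', mul_assoc]
  have e2 : centroidSum d b * ((1 - a ^ d) * (1 - b ^ d)) =
      d / (d + 1) * ((1 - b ^ (d + 1)) * (1 - a ^ d)) := by
    rw [mul_comm (1 - a ^ d), ← mul_assoc, hB', mul_assoc]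
  rw [e1, e2]
  refine mul_lt_mul_of_pos_left ?_ hd
  rw [pow_succ, pow_succ]
  nlinarith

theorem centroidSum_gt {t : ℝ} (ht : 0 < t) (ht' : t ≤ 1 / 4) :
    d / (d + 1) < centroidSum d t := by
  have hA : 0 < 1 - t ^ d := sub_pos.2 (pow_lt_one₀ ht.le (by linarith) (NeZero.ne d))
  have hd : (0 : ℝ) < d / (d + 1) := by
    have : (0 : ℝ) < d := by exact_mod_cast NeZero.pos d
    positivity
  rw [← mul_lt_mul_iff_left₀ hA, centroidSum_eq ht ht']
  refine mul_lt_mul_of_pos_left ?_ hd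
  have : 0 < t ^ d := by positivity
  rw [pow_succ]
  nlinarith

/-- Equality holds at t = 0. For small t > 0 the loss of order t outweighs the gain of order t^d;
this needs d ≥ 2. The bound ensures later that the facet ∑ xᵢ = 1 does not cut the core. -/
theorem centroidSum_mul_lt (hd : 2 ≤ d) {t : ℝ} (ht : 0 < t) (ht' : t ≤ 1 / 4) :
    centroidSum d t * (d + 1 - t) < d := by
  have hA : 0 < 1 - t ^ d := sub_pos.2 (pow_lt_one₀ ht.le (by linarith) (NeZero.ne d))
  rw [← mul_lt_mul_iff_left₀ hA, mul_right_comm, centroidSum_eq ht ht']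
  have hd0 : (0 : ℝ) < d := by exact_mod_cast NeZero.pos d
  have key : (1 - t ^ (d + 1)) * (d + 1 - t) < (d + 1) * (1 - t ^ d) := by
    obtain ⟨n, rfl⟩ := Nat.exists_eq_add_of_le hd
    have h1 : t ^ (n + 1) * (n + 3) ≤ 3 / 4 := by
      have h2 : ∀ n : ℕ, (1 / 4 : ℝ) ^ (n + 1) * (n + 3) ≤ 3 / 4 := by
        intro n
        induction n with
        | zero => norm_num
        | succ n ih =>
          have : (0 : ℝ) < (1 / 4) ^ (n + 1) := by positivity
          rw [pow_succ]
          push_cast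
          nlinarith
      refine le_trans ?_ (h2 n)
      gcongr
    have h3 : t ^ (n + 3) ≤ t := by
      calc t ^ (n + 3) ≤ t ^ 1 := pow_le_pow_of_le_one ht.le (by linarith) (by omega)
        _ = t := pow_one t
    -- This is `key` with d = n + 2, expanded and divided by t.
    have h4 : t ^ (n + 1) * (n + 3) * (1 - t) + t ^ (n + 3) < 1 := by nlinarith
    have h5 := mul_lt_mul_of_pos_left h4 ht
    push_cast
    have e1 : t ^ (2 + n) = t * t ^ (n + 1) := by ring
    have e2 : t ^ (2 + n + 1) = t ^ 2 * t ^ (n + 1) := by ring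
    have e3 : t ^ (n + 3) = t ^ 2 * t ^ (n + 1) := by ring
    rw [e1, e2]
    rw [e3] at h5
    nlinarith
  rw [mul_assoc, div_mul_eq_mul_div, div_lt_iff₀ (by positivity), mul_assoc]
  refine mul_lt_mul_of_pos_left ?_ hd0
  linarith

end Centroid

/-! ### The core of a truncated simplex -/

section CoreTrunc

variable {d : ℕ} [NeZero d] {κ t : ℝ} (hκ : κ ≠ 0)

/-- The two hypotheses say that the homothety keeps the slab t ≤ ∑ xᵢ ≤ 1 inside itself, so only the
facets xᵢ = 0 can cut the core. -/
theorem mem_core_truncSimplex (hκ0 : 0 < κ) (ht' : t ≤ 1 / 4)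
    (h1 : κ * (1 - centroidSum d t) ≤ centroidSum d t - t)
    (h2 : κ * (centroidSum d t - t) ≤ 1 - centroidSum d t) {x : Space d} :
    x ∈ (truncSimplex d t).core κ hκ ↔
      x ∈ (truncSimplex d t).toSet ∧ ∀ i, κ * x i ≤ (1 + κ) * (centroidSum d t / d) := by
  rw [Body.mem_core]
  refine and_congr_right fun hx => ?_
  rw [truncSimplex_toSet ht'] at hx ⊢
  obtain ⟨-, hx2, hx3⟩ := hx
  change (∀ i, _) ∧ t ≤ _ ∧ _ ≤ (1 : ℝ) ↔ _
  rw [map_sub, map_smul, map_sub, smul_eq_mul]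
  change (∀ i, _) ∧ t ≤ centroidSum d t - κ * (_ - centroidSum d t) ∧
    centroidSum d t - κ * (_ - centroidSum d t) ≤ 1 ↔ _
  have a : t ≤ centroidSum d t - κ * (coordSum d x - centroidSum d t) := by nlinarith
  have b : centroidSum d t - κ * (coordSum d x - centroidSum d t) ≤ 1 := by nlinarith
  rw [and_iff_left ⟨a, b⟩]
  refine forall_congr' fun i => ?_
  simp only [PiLp.sub_apply, PiLp.smul_apply, smul_eq_mul, centroid_truncSimplex_apply]
  constructor <;> intro h <;> linarith

theorem coreRatio_truncSimplex_eq_one (hκ0 : 0 < κ) (ht' : t ≤ 1 / 4)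
    (h1 : κ * (1 - centroidSum d t) ≤ centroidSum d t - t)
    (h2 : κ * (centroidSum d t - t) ≤ 1 - centroidSum d t)
    (h3 : κ ≤ (1 + κ) * (centroidSum d t / d)) : coreRatio hκ (truncSimplex d t) = 1 := by
  have : (truncSimplex d t).core κ hκ = (truncSimplex d t).toSet := by
    ext x
    rw [mem_core_truncSimplex hκ hκ0 ht' h1 h2, and_iff_left_iff_imp]
    intro hx i
    rw [truncSimplex_toSet ht'] at hx
    have hxi : x i ≤ coordSum d x := by
      rw [coordSum_apply]
      exact Finset.single_le_sum (f := fun i => x i) (fun i _ => hx.1 i) (Finset.mem_univ i)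
    have := hx.2.2
    nlinarith
  rw [coreRatio, this, ← Body.vol, inv_mul_cancel₀ (Body.vol_pos _).ne']

omit [NeZero d] in
theorem coreRatio_eq (C : Body d) :
    coreRatio hκ C = 1 - C.vol⁻¹ * ∫ _ in C.toSet \ C.core κ hκ, (1 : ℝ) := by
  have h := setIntegral_sdiff (f := fun _ => (1 : ℝ)) (μ := volume) (C.isClosed_core hκ).measurableSet
    (C.integrableOn continuous_const) (Set.inter_subset_left)
  rw [h, ← Body.vol, mul_sub, inv_mul_cancel₀ C.vol_pos.ne', coreRatio]
  ring

omit [NeZero d] in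
-- The moment of the whole body about its centroid vanishes.
theorem coordSum_coreMoment (C : Body d) :
    coordSum d (coreMoment hκ C) =
      -(C.vol⁻¹ * ∫ x in C.toSet \ C.core κ hκ, (coordSum d x - coordSum d (centroid C))) := by
  have hc : Continuous fun x : Space d => coordSum d x - coordSum d (centroid C) :=
    (coordSum d).continuous.sub continuous_const
  rw [setIntegral_sdiff (C.isClosed_core hκ).measurableSet (C.integrableOn hc)
    Set.inter_subset_left, integral_sub (C.integrableOn (coordSum d).continuous)
    (C.integrableOn continuous_const), coreMoment_eq, map_smul,
    ← ContinuousLinearMap.integral_comp_comm _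
      (C.integrableOn_core (F := fun x => x - centroid C) hκ
        (continuous_id.sub continuous_const))]
  simp only [map_sub, smul_eq_mul]
  have h0 : ∫ x in C.toSet, coordSum d x = ∫ _ in C.toSet, coordSum d (centroid C) := by
    rw [← one_mul (coordSum d (centroid C)), ← smul_eq_mul, integral_smul_const,
      coordSum_centroid, smul_eq_mul, ← Body.vol, mul_inv_cancel_left₀ C.vol_pos.ne']
  rw [h0, sub_self, zero_sub]
  simp

/-- By `h3` the vertex e₀ violates the core condition strictly, and every neighbourhood of a vertex
contains interior points of the body. -/
theorem coreRatio_truncSimplex_lt_one (hκ0 : 0 < κ) (ht' : t ≤ 1 / 4)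
    (h1 : κ * (1 - centroidSum d t) ≤ centroidSum d t - t)
    (h2 : κ * (centroidSum d t - t) ≤ 1 - centroidSum d t)
    (h3 : (1 + κ) * (centroidSum d t / d) < κ) : coreRatio hκ (truncSimplex d t) < 1 := by
  set C := truncSimplex d t with hC
  have hU : IsOpen {x : Space d | (1 + κ) * (centroidSum d t / d) < κ * x 0} :=
    isOpen_lt continuous_const (by fun_prop)
  have hmem : EuclideanSpace.single (0 : Fin d) (1 : ℝ) ∈ closure (interior C.toSet) := by
    rw [C.1.convex.closure_interior_eq_closure_of_nonempty_interior C.2]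
    refine subset_closure ?_
    rw [show (C.1 : Set (Space d)) = truncSet d t from truncSimplex_toSet ht']
    refine ⟨fun i => ?_, ?_, ?_⟩
    · rw [PiLp.single_apply]
      split_ifs <;> norm_num
    · rw [coordSum_single]; linarith
    · rw [coordSum_single]
  have hne := mem_closure_iff.1 hmem _ hU (by simpa using h3)
  have hsub : {x : Space d | (1 + κ) * (centroidSum d t / d) < κ * x 0} ∩ interior C.toSet ⊆
      C.toSet \ C.core κ hκ := by
    rintro x ⟨hx1, hx2⟩
    refine ⟨interior_subset hx2, fun h => ?_⟩
    rw [mem_core_truncSimplex hκ hκ0 ht' h1 h2] at h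
    exact absurd (h.2 0) (not_le.2 hx1)
  have hpos : 0 < volume (C.toSet \ C.core κ hκ) :=
    ((hU.inter isOpen_interior).measure_pos volume hne).trans_le (measure_mono hsub)
  have hfin : volume (C.toSet \ C.core κ hκ) ≠ ⊤ :=
    ((measure_mono Set.sdiff_subset).trans_lt C.1.isCompact.measure_lt_top).ne
  rw [coreRatio_eq, setIntegral_const, smul_eq_mul, mul_one, measureReal_def]
  have := mul_pos (inv_pos.2 C.vol_pos) (ENNReal.toReal_pos hpos.ne' hfin)
  linarith

/-- A removed point has a coordinate xᵢ with κ xᵢ > (1 + κ) G/d ≥ κ G, where G is the centroid's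
coordinate sum; the last step is `hκd`. So removed points have coordinate sum above G, and the
core's moment points the other way. -/
theorem coordSum_coreMoment_truncSimplex_neg (hκ0 : 0 < κ) (ht' : t ≤ 1 / 4)
    (hG : 0 < centroidSum d t) (hκd : κ * (d - 1) ≤ 1)
    (h1 : κ * (1 - centroidSum d t) ≤ centroidSum d t - t)
    (h2 : κ * (centroidSum d t - t) ≤ 1 - centroidSum d t)
    (h3 : coreRatio hκ (truncSimplex d t) < 1) :
    coordSum d (coreMoment hκ (truncSimplex d t)) < 0 := by
  set C := truncSimplex d t with hC
  have hd0 : (0 : ℝ) < d := by exact_mod_cast NeZero.pos d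
  have hpos (x) (hx : x ∈ C.toSet \ C.core κ hκ) : 0 < coordSum d x - coordSum d (centroid C) := by
    obtain ⟨hx1, hx2⟩ := hx
    rw [mem_core_truncSimplex hκ hκ0 ht' h1 h2] at hx2
    push Not at hx2
    obtain ⟨i, hi⟩ := hx2 hx1
    have hxi : x i ≤ coordSum d x := by
      rw [coordSum_apply]
      exact Finset.single_le_sum (f := fun i => x i) (fun i _ => hx1.1 i) (Finset.mem_univ i)
    change 0 < coordSum d x - centroidSum d t
    have e : κ * centroidSum d t ≤ (1 + κ) * (centroidSum d t / d) := by
      rw [← mul_div_assoc, le_div_iff₀ hd0]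
      nlinarith
    nlinarith
  have hm : MeasurableSet (C.toSet \ C.core κ hκ) :=
    C.measurableSet.diff (C.isClosed_core hκ).measurableSet
  have hc : Continuous fun x : Space d => coordSum d x - coordSum d (centroid C) :=
    (coordSum d).continuous.sub continuous_const
  rw [coordSum_coreMoment, neg_lt_zero]
  refine mul_pos (inv_pos.2 C.vol_pos) ?_
  rw [setIntegral_pos_iff_support_of_nonneg_ae
    ((ae_restrict_iff' hm).2 (Eventually.of_forall fun x hx => (hpos x hx).le))
    ((C.integrableOn hc).mono_set Set.sdiff_subset)]
  have hsupp : Function.support (fun x : Space d => coordSum d x - coordSum d (centroid C)) ∩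
      (C.toSet \ C.core κ hκ) = C.toSet \ C.core κ hκ :=
    Set.inter_eq_right.2 fun x hx => (hpos x hx).ne'
  rw [hsupp, pos_iff_ne_zero]
  intro h0
  rw [coreRatio_eq, setIntegral_const, measureReal_def, h0] at h3
  simp at h3

end CoreTrunc

/-- Near every small `b` there is a truncation `s` at which the moment of the core is nonzero and
the proportion of the core is not locally constant. -/
theorem exists_coreMoment_ne_zero {d : ℕ} [NeZero d] (hd : 2 ≤ d) {b : ℝ} (hb : 0 < b)
    (hb' : b ≤ 1 / 4) :
    ∃ (κ : ℝ) (hκ : κ ≠ 0) (a s : ℝ), 0 < a ∧ a < s ∧ s ≤ b ∧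
      coordSum d (coreMoment hκ (truncSimplex d s)) < 0 ∧
      ∀ t, a ≤ t → t < s →
        coreRatio hκ (truncSimplex d t) < coreRatio hκ (truncSimplex d s) := by
  set G := centroidSum d with hGdef
  have hd2 : (2 : ℝ) ≤ d := by exact_mod_cast hd
  have hlo (t : ℝ) (ht : 0 < t) (ht' : t ≤ 1 / 4) : 2 / 3 < G t := by
    refine lt_of_le_of_lt ?_ (centroidSum_gt (d := d) ht ht')
    rw [div_le_div_iff₀ (by norm_num) (by positivity)]
    linarith
  have hup := centroidSum_mul_lt hd hb hb'
  have hGb := hlo b hb hb'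
  have hGb1 : G b < 1 := by
    by_contra! h
    have : (1 : ℝ) * (d + 1 - b) ≤ G b * (d + 1 - b) := by gcongr; linarith
    linarith
  have hden : 0 < d - G b := by linarith
  -- The threshold κ d = (1 + κ) G(b): the homothety at the centroid of C_b sends each vertex eᵢ
  -- exactly onto the facet xᵢ = 0.
  set κ := G b / (d - G b) with hκdef
  have hκ0 : 0 < κ := div_pos (by linarith) hden
  have hκeq : κ * (d - G b) = G b := div_mul_cancel₀ _ hden.ne'
  have hκd : κ * (d - 1) ≤ 1 := by
    rw [hκdef, div_mul_eq_mul_div, div_le_one hden]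
    nlinarith
  have hκ1 : κ ≤ 1 := by nlinarith
  have hcond (t : ℝ) (ht : 0 < t) (ht' : t ≤ 1 / 4) : κ * (1 - G t) ≤ G t - t := by
    have := hlo t ht ht'
    rcases le_total (G t) 1 with h | h <;> nlinarith
  -- With denominators cleared this is G(b)(d + 1 - b) < d, that is, `hup`.
  have hstrict : κ * (G b - b) < 1 - G b := by
    rw [hκdef, div_mul_eq_mul_div, div_lt_iff₀ hden]
    nlinarith
  have hGcont : Continuous G := continuous_centroidSum
  obtain ⟨a, ha, hab, hnear⟩ : ∃ a, 0 < a ∧ a < b ∧ ∀ t ∈ Set.Icc a b, κ * (G t - t) < 1 - G t := by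
    have hev : ∀ᶠ t in 𝓝[≤] b, κ * (G t - t) < 1 - G t :=
      nhdsWithin_le_nhds ((isOpen_lt (continuous_const.mul (hGcont.sub continuous_id))
        (continuous_const.sub hGcont)).mem_nhds hstrict)
    obtain ⟨l, hl, hl'⟩ := (mem_nhdsLE_iff_exists_Ioc_subset' hb).1 hev
    obtain ⟨a, ha1, ha2⟩ := exists_between (max_lt hl hb)
    exact ⟨a, (le_max_right _ _).trans_lt ha1, ha2, fun t ht =>
      hl' ⟨((le_max_left _ _).trans_lt ha1).trans_le ht.1, ht.2⟩⟩
  set R : ℝ → ℝ := fun t => coreRatio hκ0.ne' (truncSimplex d t) with hR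
  have hRcont : Continuous R := (continuous_coreRatio _).comp (continuous_truncSimplex d)
  have hRb : R b = 1 := by
    refine coreRatio_truncSimplex_eq_one _ hκ0 hb' (hcond b hb hb') hstrict.le ?_
    change κ ≤ (1 + κ) * (G b / d)
    rw [← mul_div_assoc, le_div_iff₀ (by linarith)]
    linarith
  have hRa : R a < 1 := by
    refine coreRatio_truncSimplex_lt_one _ hκ0 (by linarith) (hcond a ha (by linarith))
      (hnear a ⟨le_rfl, hab.le⟩).le ?_
    change (1 + κ) * (G a / d) < κ
    have := centroidSum_lt (d := d) ha hab hb'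
    rw [← mul_div_assoc, div_lt_iff₀ (by linarith)]
    change G a < G b at this
    nlinarith
  -- Let s be the first parameter in [a, b] at which R reaches v. Then R stays below R(s) before s,
  -- and R(s) ≤ v < 1 makes the moment nonzero.
  obtain ⟨v, hv1, hv2⟩ := exists_between hRa
  set S := {t | t ∈ Set.Icc a b ∧ v ≤ R t} with hS
  have hScl : IsCompact S :=
    isCompact_Icc.inter_right (isClosed_le continuous_const hRcont)
  have hSne : S.Nonempty := ⟨b, ⟨hab.le, le_rfl⟩, by rw [hRb]; exact hv2.le⟩
  obtain ⟨s, ⟨hs1, hs2⟩, hsmin⟩ := hScl.exists_isLeast hSne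
  have hbefore (t : ℝ) (h1 : a ≤ t) (h2 : t < s) : R t < v := by
    by_contra! h
    exact absurd (hsmin ⟨⟨h1, h2.le.trans hs1.2⟩, h⟩) (not_le.2 h2)
  have has : a < s := by
    refine lt_of_le_of_ne hs1.1 ?_
    rintro rfl
    linarith
  have hRs : R s ≤ v := by
    refine le_of_tendsto ((hRcont.tendsto s).mono_left (nhdsWithin_le_nhds (s := Set.Iio s))) ?_
    filter_upwards [Ioo_mem_nhdsLT has] with t ht
    exact (hbefore t ht.1.le ht.2).le
  refine ⟨κ, hκ0.ne', a, s, ha, has, hs1.2, ?_, fun t h1 h2 => (hbefore t h1 h2).trans_le hs2⟩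
  have hs0 : 0 < s := ha.trans has
  have hs4 : s ≤ 1 / 4 := hs1.2.trans hb'
  exact coordSum_coreMoment_truncSimplex_neg _ hκ0 hs4 (by have := hlo s hs0 hs4; linarith) hκd
    (hcond s hs0 hs4) (hnear s hs1).le (hRs.trans_lt hv2)

/-! ### Affine points of truncated simplices depend continuously on the affine point -/

/-- An affine image of every truncated simplex lies between the unit ball and the ball of
radius `d`. -/
theorem exists_map_truncSimplex_mem_pinched {d : ℕ} [NeZero d] (hd : 2 ≤ d) :
    ∃ (α β γ : ℝ) (hα : α ≠ 0) (hβ : α + d * β ≠ 0), ∀ t ≤ (1 / 4 : ℝ),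
      (truncSimplex d t).map (axial d α β γ hα hβ) ∈ pinched d := by
  have hd2 : (2 : ℝ) ≤ d := by exact_mod_cast hd
  have hd0 : (0 : ℝ) < d := by linarith
  set w : ℝ := 1 / (d + 1) with hw
  have hw1 : (d + 1) * w = 1 := mul_one_div_cancel (by positivity)
  have hw0 : 0 < w := by positivity
  set r := √((d : ℝ) + 1) with hr
  set m := √(d : ℝ) with hm
  have hr0 : 0 < r := Real.sqrt_pos.2 (by positivity)
  have hm0 : 0 < m := Real.sqrt_pos.2 hd0
  have hr2 : r ^ 2 = d + 1 := Real.sq_sqrt (by positivity)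
  have hm2 : m ^ 2 = d := Real.sq_sqrt hd0.le
  set c := (r - 1) / d with hc
  have hcd : d * c = r - 1 := mul_div_cancel₀ _ hd0.ne'
  have hα : m * r ≠ 0 := (mul_pos hm0 hr0).ne'
  have hβ : m * r + d * (m * r * c) ≠ 0 := by
    rw [show m * r + d * (m * r * c) = m * r * (1 + d * c) by ring, hcd]
    have : 1 + (r - 1) = r := by ring
    rw [this]
    positivity
  refine ⟨m * r, m * r * c, -m, hα, hβ, fun t ht => ?_⟩
  set T := axial d (m * r) (m * r * c) (-m) hα hβ with hT
  have hsum (x : Space d) : ∑ i, (x i - w) = coordSum d x - d * w := by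
    rw [Finset.sum_sub_distrib, coordSum_apply]; simp
  -- Up to the factor d(d + 1) this sums (xᵢ - w)² over all d + 1 barycentric coordinates, as x₀ - w
  -- = d w - ∑ xᵢ. So T makes the full simplex regular, centred at 0, with inradius 1 and
  -- circumradius d; c is a root of d c² + 2c = 1.
  have hnorm (x : Space d) : ‖T x‖ ^ 2 =
      d * (d + 1) * (∑ i, (x i - w) ^ 2 + (coordSum d x - d * w) ^ 2) := by
    rw [EuclideanSpace.real_norm_sq_eq]
    have e (i : Fin d) : T x i ^ 2 = d * (d + 1) * ((x i - w) ^ 2 +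
        2 * c * (coordSum d x - d * w) * (x i - w) + (c * (coordSum d x - d * w)) ^ 2) := by
      rw [hT, axial_apply]
      have h0 : m * r * w * (1 + d * c) = m := by
        rw [hcd]
        linear_combination m * w * hr2 + m * hw1
      rw [show m * r * x i + m * r * c * coordSum d x + -m =
        m * r * ((x i - w) + c * (coordSum d x - d * w)) by linear_combination h0, mul_pow,
        mul_pow, hm2, hr2]
      ring
    rw [Finset.sum_congr rfl fun i _ => e i, ← Finset.mul_sum, Finset.sum_add_distrib,
      Finset.sum_add_distrib, ← Finset.mul_sum, hsum, Finset.sum_const, Finset.card_univ,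
      Fintype.card_fin, nsmul_eq_mul]
    have h1 : 2 * c + d * c ^ 2 = 1 := by
      have : d * (2 * c + d * c ^ 2) = d * 1 := by
        linear_combination (d * c + r + 1) * hcd + hr2
      exact mul_left_cancel₀ hd0.ne' this
    linear_combination (d * (d + 1) * (coordSum d x - d * w) ^ 2) * h1
  have hset := truncSimplex_toSet (d := d) ht
  constructor
  · intro y hy
    refine ⟨T.symm y, ?_, T.apply_symm_apply y⟩
    set x := T.symm y with hx
    have hxy : T x = y := T.apply_symm_apply y
    rw [mem_closedBall_zero_iff, ← hxy, ← sq_le_one_iff₀ (norm_nonneg _), hnorm] at hy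
    set s := coordSum d x - d * w with hs
    set Q := ∑ i, (x i - w) ^ 2 with hQ
    have hsmall (z : ℝ) (hz : (d + 1) * z ^ 2 ≤ d * (Q + s ^ 2)) : |z| ≤ w := by
      refine abs_le_of_sq_le_sq ?_ hw0.le
      have h1 : (d + 1) * ((d + 1) * z ^ 2) ≤ ((d + 1) * w) ^ 2 := by
        rw [hw1]
        nlinarith
      have h2 : 0 < ((d : ℝ) + 1) ^ 2 := by positivity
      refine le_of_mul_le_mul_left ?_ h2
      linarith
    have hsQ : s ^ 2 ≤ d * Q := by
      have := sq_sum_le_card_mul_sum_sq (s := Finset.univ) (f := fun i => x i - w)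
      rw [hsum] at this
      simpa using this
    have hs' := abs_le.1 (hsmall s (by linarith))
    have hi (i : Fin d) : |x i - w| ≤ w := by
      refine hsmall _ ?_
      set u := x i - w with hu
      -- Cauchy–Schwarz for the other d barycentric deviations: they sum to -u, so their mean is
      -- -u/d.
      have h1 : ∑ j, (x j - w + u / d) ^ 2 = Q + 2 * (u / d) * s + d * (u / d) ^ 2 := by
        have (j : Fin d) : (x j - w + u / d) ^ 2 =
          (x j - w) ^ 2 + 2 * (u / d) * (x j - w) + (u / d) ^ 2 := by ring
        rw [Finset.sum_congr rfl fun j _ => this j, Finset.sum_add_distrib,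
          Finset.sum_add_distrib, ← Finset.mul_sum, hsum]
        simp
        rfl
      have h2 : (u + u / d) ^ 2 ≤ ∑ j, (x j - w + u / d) ^ 2 :=
        Finset.single_le_sum (f := fun j => (x j - w + u / d) ^ 2) (fun j _ => sq_nonneg _)
          (Finset.mem_univ i)
      have h3 : d * (u / d) = u := mul_div_cancel₀ _ hd0.ne'
      set v := u / d with hv
      have h4 : 0 ≤ d * ((s - v) ^ 2 + (Q + 2 * v * s + d * v ^ 2 - (u + v) ^ 2)) := by
        refine mul_nonneg hd0.le (add_nonneg (sq_nonneg _) ?_)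
        linarith
      rw [← h3] at h4 ⊢
      nlinarith
    rw [hset]
    refine ⟨fun i => ?_, ?_, ?_⟩
    · linarith [(abs_le.1 (hi i)).1]
    · have : 1 / 4 ≤ (d - 1) * w := by
        rw [hw, mul_one_div, div_le_div_iff₀ (by norm_num) (by positivity)]
        linarith
      linarith
    · linarith
  · rintro y ⟨x, hx, rfl⟩
    rw [hset] at hx
    obtain ⟨h1, h2, h3⟩ := hx
    rw [mem_closedBall_zero_iff]
    refine le_of_sq_le_sq ?_ hd0.le
    change ‖T x‖ ^ 2 ≤ _
    rw [hnorm]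
    have e : ∑ i, (x i - w) ^ 2 = ∑ i, x i ^ 2 - 2 * w * coordSum d x + d * w ^ 2 := by
      have (i : Fin d) : (x i - w) ^ 2 = x i ^ 2 - 2 * w * x i + w ^ 2 := by ring
      rw [Finset.sum_congr rfl fun i _ => this i, Finset.sum_add_distrib,
        Finset.sum_sub_distrib, ← Finset.mul_sum, ← coordSum_apply]
      simp
    have h0 : 0 ≤ coordSum d x := by
      rw [coordSum_apply]; exact Finset.sum_nonneg fun i _ => h1 i
    have h4 : ∑ i, x i ^ 2 ≤ coordSum d x := by
      rw [coordSum_apply]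
      refine Finset.sum_le_sum fun i _ => ?_
      have : x i ≤ 1 := (Finset.single_le_sum (f := fun i => x i) (fun i _ => h1 i)
        (Finset.mem_univ i)).trans (by rw [← coordSum_apply]; exact h3)
      nlinarith [h1 i]
    have h5 : ∑ i, (x i - w) ^ 2 + (coordSum d x - d * w) ^ 2 ≤ 1 - w := by
      rw [e]
      set s := coordSum d x with hs
      have h6 : s + s ^ 2 ≤ 2 * s := by nlinarith
      have h7 : 2 * w * s + 2 * s * (d * w) = 2 * s := by linear_combination 2 * s * hw1
      have h8 : d * w ^ 2 + (d * w) ^ 2 = 1 - w := by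
        linear_combination (d * w + 1) * hw1
      nlinarith
    calc d * (d + 1) * (∑ i, (x i - w) ^ 2 + (coordSum d x - d * w) ^ 2)
        ≤ d * (d + 1) * (1 - w) := by gcongr
      _ = (d : ℝ) ^ 2 := by linear_combination (-(d : ℝ)) * hw1

/-- On truncated simplices, affine points are uniformly Lipschitz functions of the affine point. -/
theorem exists_abs_coordSum_sub_le {d : ℕ} [NeZero d] (hd : 2 ≤ d) :
    ∃ K : ℝ, 0 ≤ K ∧ ∀ (p q : AffinePoint d), ∀ t ≤ (1 / 4 : ℝ),
      |coordSum d (p (truncSimplex d t)) - coordSum d (q (truncSimplex d t))| ≤ K * dist p q := by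
  obtain ⟨α, β, γ, hα, hβ, h⟩ := exists_map_truncSimplex_mem_pinched hd
  refine ⟨|α + d * β|⁻¹ * ‖coordSum d‖, by positivity, fun p q t ht => ?_⟩
  set C := truncSimplex d t
  have hp := coordSum_axial (γ := γ) hα hβ (p C)
  have hq := coordSum_axial (γ := γ) hα hβ (q C)
  rw [← p.map_map'] at hp
  rw [← q.map_map'] at hq
  have e : (α + d * β) * (coordSum d (p C) - coordSum d (q C)) =
      coordSum d (p (C.map (axial d α β γ hα hβ)) - q (C.map (axial d α β γ hα hβ))) := by
    rw [map_sub, hp, hq]; ring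
  have hle : ‖p (C.map (axial d α β γ hα hβ)) - q (C.map (axial d α β γ hα hβ))‖ ≤ dist p q := by
    rw [dist_def]
    exact le_ciSup (bddAbove_norm_sub p q) ⟨_, h t ht⟩
  rw [mul_assoc, ← div_eq_inv_mul, le_div_iff₀ (abs_pos.2 hβ), mul_comm, ← abs_mul, e,
    ← Real.norm_eq_abs]
  exact ((coordSum d).le_opNorm _).trans (by gcongr)

/-! ### The obstruction to duality -/

/-- A linear inequality on the body need only be checked at its vertices eᵢ and t eᵢ. -/
theorem mem_polarAt_truncSimplex {d : ℕ} [NeZero d] (p : AffinePoint d) {t : ℝ} (ht : 0 < t)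
    (ht' : t ≤ 1 / 4) (h : p (truncSimplex d t) ∈ interior (truncSimplex d t).toSet)
    (y : Space d) :
    y ∈ ((truncSimplex d t).polarAt _ h).toSet ↔
      ∀ i, 0 ≤ 1 + coordSum d (p (truncSimplex d t)) / d * coordSum d y - y i ∧
        0 ≤ 1 + coordSum d (p (truncSimplex d t)) / d * coordSum d y - t * y i := by
  set C := truncSimplex d t with hC
  set q := coordSum d (p C) / d with hq
  have hinner (x : Space d) : ⟪x - p C, y⟫ = ∑ i, x i * y i - q * coordSum d y := by
    rw [inner_sub_left, PiLp.inner_apply, PiLp.inner_apply, coordSum_apply, Finset.mul_sum]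
    congr 1
    · exact Finset.sum_congr rfl fun i _ => by simp [mul_comm]
    · exact Finset.sum_congr rfl fun i _ => by rw [p.truncSimplex_apply]; simp [mul_comm, hq, hC]
  change (∀ z ∈ (fun x => x - p C) '' C.toSet, ⟪z, y⟫ ≤ 1) ↔ _
  rw [Set.forall_mem_image]
  have hset : C.toSet = truncSet d t := truncSimplex_toSet ht'
  rw [hset]
  constructor
  · intro hy i
    have hsingle (s : ℝ) (h1 : t ≤ s) (h2 : s ≤ 1) :
        0 ≤ 1 + q * coordSum d y - s * y i := by
      have := hy (x := EuclideanSpace.single i s) ⟨fun j => ?_, ?_, ?_⟩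
      · rw [hinner] at this
        simp at this
        linarith
      · rw [PiLp.single_apply]
        split_ifs <;> linarith
      · rwa [coordSum_single]
      · rwa [coordSum_single]
    exact ⟨by simpa using hsingle 1 (by linarith) le_rfl, hsingle t le_rfl (by linarith)⟩
  · rintro hy x ⟨h1, h2, h3⟩
    rw [hinner]
    set s := coordSum d x with hs
    set m := 1 + q * coordSum d y with hm
    -- The point x is the average of the points s eᵢ with weights xᵢ/s, and each s eᵢ lies between t
    -- eᵢ and eᵢ.
    have key : s * ∑ i, x i * y i ≤ s * m := by
      rw [Finset.mul_sum, hs, coordSum_apply, Finset.sum_mul, ← coordSum_apply, ← hs]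
      refine Finset.sum_le_sum fun i _ => ?_
      have hsy : s * y i ≤ m := by
        obtain ⟨ha, hb⟩ := hy i
        rcases le_total 0 (y i) with h0 | h0 <;> nlinarith
      have := mul_le_mul_of_nonneg_left hsy (h1 i)
      linarith
    have := le_of_mul_le_mul_left key (ht.trans_le h2)
    linarith

/-- If `p` has a dual, then a certain cross-ratio determines the truncation of the simplex. -/
theorem AffinePoint.IsDual.eq_of_crossRatio_eq {d : ℕ} [NeZero d] {p q : AffinePoint d}
    (hpq : p.IsDual q) {t₁ t₂ : ℝ} (ht₁ : 0 < t₁) (ht₁' : t₁ ≤ 1 / 4) (ht₂ : 0 < t₂)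
    (ht₂' : t₂ ≤ 1 / 4) {q₁ q₂ : ℝ} (hq₁ : coordSum d (p (truncSimplex d t₁)) = q₁)
    (hq₂ : coordSum d (p (truncSimplex d t₂)) = q₂) (h₁ : t₁ < q₁) (h₁' : q₁ < 1)
    (h₂ : t₂ < q₂) (h₂' : q₂ < 1)
    (h : (1 - q₁) * t₁ * q₂ * (1 - t₂) = (1 - q₂) * t₂ * q₁ * (1 - t₁)) : t₁ = t₂ := by
  have hd0 : (0 : ℝ) < d := by exact_mod_cast NeZero.pos d
  have hint (t : ℝ) (ht : 0 < t) (ht' : t ≤ 1 / 4) (h : t < coordSum d (p (truncSimplex d t)))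
      (h' : coordSum d (p (truncSimplex d t)) < 1) :
      p (truncSimplex d t) ∈ interior (truncSimplex d t).toSet := by
    have e : p (truncSimplex d t) = diag d (coordSum d (p (truncSimplex d t)) / d) := by
      ext i
      exact p.truncSimplex_apply t i
    rw [e]
    exact diag_mem_interior_truncSimplex ht.le ht' h h'
  have hi₁ := hint t₁ ht₁ ht₁' (by rwa [hq₁]) (by rwa [hq₁])
  have hi₂ := hint t₂ ht₂ ht₂' (by rwa [hq₂]) (by rwa [hq₂])
  -- The constants solve the requirement that Φ pull the two families of inequalities for t₂ back to
  -- μ and ν times those for t₁. The system has one equation too many, `e5`, and that is where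
  -- equality of cross-ratios enters.
  set D := t₂ * (1 - q₂) + t₁ * (q₂ - t₂) with hD
  have hD0 : 0 < D := add_pos (mul_pos ht₂ (by linarith)) (mul_pos ht₁ (by linarith))
  set μ := t₁ * (1 - t₂) / D with hμ
  set ν := t₂ * (1 - t₂) / D with hν
  set γ := (t₂ - t₁) / D with hγ
  set b := (q₁ - q₂) * μ / (q₂ - 1) with hb
  have hμ0 : 0 < μ := div_pos (mul_pos ht₁ (by linarith)) hD0
  have hν0 : 0 < ν := div_pos (mul_pos ht₂ (by linarith)) hD0
  have e1 : 1 + q₂ * γ - γ = μ := by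
    rw [hγ, hμ]; field_simp; rw [hD]; ring
  have e2 : 1 + q₂ * γ - t₂ * γ = ν := by
    rw [hγ, hν]; field_simp; rw [hD]; ring
  have e3 : t₂ * μ = ν * t₁ := by rw [hμ, hν]; ring
  have hq2 : q₂ - 1 ≠ 0 := by linarith
  have e4 : b * (q₂ - 1) = (q₁ - q₂) * μ := div_mul_cancel₀ _ hq2
  have e5 : q₂ * (μ + b) - t₂ * b = ν * q₁ := by
    have : (q₂ - 1) * t₁ * (q₂ * (μ + b) - t₂ * b) = (q₂ - 1) * t₁ * (ν * q₁) := by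
      linear_combination t₁ * (q₂ - t₂) * e4 + (q₂ - 1) * q₁ * e3 - μ * h
    exact mul_left_cancel₀ (mul_ne_zero hq2 ht₁.ne') this
  have hα : μ ≠ 0 := hμ0.ne'
  have hdb : d * (b / d) = b := mul_div_cancel₀ _ hd0.ne'
  have hβ : μ + d * (b / d) ≠ 0 := by
    rw [hdb]
    intro h0
    have : (q₁ - 1) * μ = 0 := by linear_combination (q₂ - 1) * h0 - e4
    rcases mul_eq_zero.1 this with h | h <;> linarith
  set Φ := axial d μ (b / d) γ hα hβ with hΦ
  have hmap : ((truncSimplex d t₁).polarAt _ hi₁).map Φ = (truncSimplex d t₂).polarAt _ hi₂ := by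
    refine Body.map_eq_of_forall_mem_iff _ fun y => ?_
    rw [mem_polarAt_truncSimplex p ht₁ ht₁', mem_polarAt_truncSimplex p ht₂ ht₂', hq₁, hq₂]
    refine forall_congr' fun i => ?_
    set s := coordSum d y with hs
    have hsum : q₂ / d * coordSum d (Φ y) = q₂ * ((μ + b) * (s / d) + γ) := by
      rw [hΦ, coordSum_axial, hdb, ← hs]
      field_simp
    have f1 : 1 + q₂ / d * coordSum d (Φ y) - Φ y i = μ * (1 + q₁ / d * s - y i) := by
      rw [hsum, hΦ, axial_apply, ← hs]
      linear_combination e1 + s / d * e4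
    have f2 : 1 + q₂ / d * coordSum d (Φ y) - t₂ * Φ y i = ν * (1 + q₁ / d * s - t₁ * y i) := by
      rw [hsum, hΦ, axial_apply, ← hs]
      linear_combination e2 + s / d * e5 - y i * e3
    rw [f1, f2, mul_nonneg_iff_of_pos_left hμ0, mul_nonneg_iff_of_pos_left hν0]
  -- The dual point is 0 on both polars, so Φ(0) = γ(1, …, 1) must be 0, and γ is a multiple of t₂ -
  -- t₁.
  have h0 := q.map_map' Φ ((truncSimplex d t₁).polarAt _ hi₁)
  rw [hmap, hpq _ hi₁, hpq _ hi₂] at h0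
  have h1 := congrArg (fun x => x 0) h0
  simp only [hΦ, axial_apply, map_zero, PiLp.zero_apply, mul_zero, zero_add] at h1
  rw [hγ, eq_comm, div_eq_zero_iff] at h1
  rcases h1 with h1 | h1 <;> linarith

/-! ### Affine points without a dual -/

/-- The sum of the coordinates of an affine point of a truncated simplex. -/
noncomputable def AffinePoint.sumAt {d : ℕ} [NeZero d] (p : AffinePoint d) (t : ℝ) : ℝ :=
  coordSum d (p (truncSimplex d t))

theorem AffinePoint.continuous_sumAt {d : ℕ} [NeZero d] (p : AffinePoint d) :
    Continuous p.sumAt :=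
  (coordSum d).continuous.comp (p.continuous_toFun.comp (continuous_truncSimplex d))

/-- The cross-ratio of the four points `0, t, q, 1`. -/
noncomputable def crossRatio (t q : ℝ) : ℝ := (1 - q) * t / (q * (1 - t))

theorem continuousAt_crossRatio {t q : ℝ} (hq : q ≠ 0) (ht : t ≠ 1) :
    ContinuousAt (fun z : ℝ × ℝ => crossRatio z.1 z.2) (t, q) := by
  have : q * (1 - t) ≠ 0 := mul_ne_zero hq (sub_ne_zero.2 ht.symm)
  exact ContinuousAt.div (by fun_prop) (by fun_prop) this

theorem crossRatio_lt {t q q' : ℝ} (ht : 0 < t) (ht' : t < 1) (hq : 0 < q) (hqq' : q < q') :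
    crossRatio t q' < crossRatio t q := by
  have h1 : 0 < 1 - t := by linarith
  rw [crossRatio, crossRatio, div_lt_div_iff₀ (mul_pos (hq.trans hqq') h1) (mul_pos hq h1)]
  have := mul_pos ht h1
  nlinarith

/-- The cross-ratio of the truncations `t` and the values of the affine point `p` takes a smaller
value at `t₂` than at `t₁ < t₂` and at `t₃ > t₂`. -/
structure AffinePoint.HasDip {d : ℕ} [NeZero d] (p : AffinePoint d) (t₁ t₂ t₃ : ℝ) : Prop where
  lt_sumAt : ∀ t ∈ Set.Icc t₁ t₃, t < p.sumAt t
  sumAt_lt : ∀ t ∈ Set.Icc t₁ t₃, p.sumAt t < 1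
  lt_left : crossRatio t₂ (p.sumAt t₂) < crossRatio t₁ (p.sumAt t₁)
  lt_right : crossRatio t₂ (p.sumAt t₂) < crossRatio t₃ (p.sumAt t₃)

/-! ### Dips exclude duals, are stable, and are dense -/

section Dip

variable {d : ℕ} [NeZero d] {p : AffinePoint d} {t₁ t₂ t₃ : ℝ}

/-- A level slightly above the value at t₂ is attained on both sides of t₂, contradicting
injectivity of the cross-ratio. -/
theorem AffinePoint.HasDip.not_exists_isDual (h : p.HasDip t₁ t₂ t₃) (ht₁ : 0 < t₁)
    (h₁₂ : t₁ ≤ t₂) (h₂₃ : t₂ ≤ t₃) (ht₃ : t₃ ≤ 1 / 4) : ¬ ∃ q, p.IsDual q := by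
  rintro ⟨q, hq⟩
  have hcont : ContinuousOn (fun t => crossRatio t (p.sumAt t)) (Set.Icc t₁ t₃) := by
    intro t ht
    have h0 : 0 < p.sumAt t := (ht₁.trans_le ht.1).trans (h.lt_sumAt t ht)
    have := (continuousAt_crossRatio h0.ne' (show t ≠ 1 by linarith [ht.2])).comp
      (f := fun t => (t, p.sumAt t)) (continuous_id.prodMk p.continuous_sumAt).continuousAt
    exact this.continuousWithinAt
  obtain ⟨v, hv, hv'⟩ := exists_between (lt_min h.lt_left h.lt_right)
  obtain ⟨u, hu, hu'⟩ := intermediate_value_Icc' h₁₂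
    (hcont.mono (Set.Icc_subset_Icc_right h₂₃)) ⟨hv.le, hv'.le.trans (min_le_left _ _)⟩
  obtain ⟨w, hw, hw'⟩ := intermediate_value_Icc h₂₃
    (hcont.mono (Set.Icc_subset_Icc_left h₁₂)) ⟨hv.le, hv'.le.trans (min_le_right _ _)⟩
  have hmu : u ∈ Set.Icc t₁ t₃ := ⟨hu.1, hu.2.trans h₂₃⟩
  have hmw : w ∈ Set.Icc t₁ t₃ := ⟨h₁₂.trans hw.1, hw.2⟩
  have hu0 : 0 < u := ht₁.trans_le hmu.1
  have hw0 : 0 < w := ht₁.trans_le hmw.1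
  have hu4 : u ≤ 1 / 4 := hmu.2.trans ht₃
  have hw4 : w ≤ 1 / 4 := hmw.2.trans ht₃
  have hqu := hu0.trans (h.lt_sumAt u hmu)
  have hqw := hw0.trans (h.lt_sumAt w hmw)
  have heq : u = w := by
    refine hq.eq_of_crossRatio_eq hu0 hu4 hw0 hw4 rfl rfl (h.lt_sumAt u hmu) (h.sumAt_lt u hmu)
      (h.lt_sumAt w hmw) (h.sumAt_lt w hmw) ?_
    have := hu'.trans hw'.symm
    simp only [crossRatio] at this
    rw [div_eq_div_iff (mul_pos hqu (by linarith)).ne' (mul_pos hqw (by linarith)).ne'] at this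
    change (1 - p.sumAt u) * u * p.sumAt w * (1 - w) = (1 - p.sumAt w) * w * p.sumAt u * (1 - u)
    linarith
  have ht2 : u = t₂ := le_antisymm hu.2 (heq ▸ hw.1)
  rw [ht2] at hu'
  exact hv.ne hu'

theorem continuous_sumAt_left (hd : 2 ≤ d) {t : ℝ} (ht : t ≤ 1 / 4) :
    Continuous fun p : AffinePoint d => p.sumAt t := by
  obtain ⟨K, hK, h⟩ := exists_abs_coordSum_sub_le hd
  exact (LipschitzWith.of_dist_le_mul (K := ⟨K, hK⟩) fun p q => h p q t ht).continuous

/-- The cross-ratio inequalities concern three parameters only. The bounds on the whole interval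
survive because they hold with a margin `m` and Q(t) is Lipschitz in p uniformly in t. -/
theorem AffinePoint.HasDip.eventually (hd : 2 ≤ d) (h : p.HasDip t₁ t₂ t₃) (ht₁ : 0 < t₁)
    (h₁₂ : t₁ ≤ t₂) (h₂₃ : t₂ ≤ t₃) (ht₃ : t₃ ≤ 1 / 4) :
    ∀ᶠ p' in 𝓝 p, p'.HasDip t₁ t₂ t₃ := by
  obtain ⟨K, hK, hL⟩ := exists_abs_coordSum_sub_le hd
  have hcr (t : ℝ) (ht : t ∈ Set.Icc t₁ t₃) :
      Tendsto (fun p' : AffinePoint d => crossRatio t (p'.sumAt t)) (𝓝 p)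
        (𝓝 (crossRatio t (p.sumAt t))) := by
    have h0 : 0 < p.sumAt t := (ht₁.trans_le ht.1).trans (h.lt_sumAt t ht)
    exact (continuousAt_crossRatio h0.ne' (show t ≠ 1 by linarith [ht.2])).comp
      (f := fun p' : AffinePoint d => (t, p'.sumAt t))
      (continuous_const.prodMk (continuous_sumAt_left hd (ht.2.trans ht₃))).continuousAt
  have hc₁ := hcr t₁ ⟨le_rfl, h₁₂.trans h₂₃⟩
  have hc₂ := hcr t₂ ⟨h₁₂, h₂₃⟩
  have hc₃ := hcr t₃ ⟨h₁₂.trans h₂₃, le_rfl⟩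
  obtain ⟨m, hm, hmt⟩ : ∃ m > 0, ∀ t ∈ Set.Icc t₁ t₃, m ≤ p.sumAt t - t ∧ m ≤ 1 - p.sumAt t := by
    obtain ⟨t₀, ht₀, hmin⟩ := isCompact_Icc.exists_isMinOn
      (Set.nonempty_Icc.2 (h₁₂.trans h₂₃))
      (f := fun t => min (p.sumAt t - t) (1 - p.sumAt t))
      (((p.continuous_sumAt.sub continuous_id).min
        (continuous_const.sub p.continuous_sumAt)).continuousOn)
    refine ⟨_, lt_min (sub_pos.2 (h.lt_sumAt t₀ ht₀)) (sub_pos.2 (h.sumAt_lt t₀ ht₀)),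
      fun t ht => ?_⟩
    exact le_min_iff.1 (hmin ht)
  have hball : ∀ᶠ p' in 𝓝 p, K * dist p' p < m := by
    have : Continuous fun p' : AffinePoint d => K * dist p' p := by fun_prop
    exact (isOpen_lt this continuous_const).mem_nhds (by simpa using hm)
  filter_upwards [hc₂.eventually_lt hc₁ h.lt_left, hc₂.eventually_lt hc₃ h.lt_right, hball]
    with p' hl hr hp'
  have hclose (t : ℝ) (ht : t ∈ Set.Icc t₁ t₃) : |p'.sumAt t - p.sumAt t| < m :=
    (hL p' p t (ht.2.trans ht₃)).trans_lt hp'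
  refine ⟨fun t ht => ?_, fun t ht => ?_, hl, hr⟩
  · linarith [(abs_lt.1 (hclose t ht)).1, (hmt t ht).1]
  · linarith [(abs_lt.1 (hclose t ht)).2, (hmt t ht).2]

/-- Arbitrarily close to every affine point there are affine points with a dip. -/
theorem AffinePoint.exists_dist_lt_hasDip (hd : 2 ≤ d) (p : AffinePoint d) {ε : ℝ} (hε : 0 < ε) :
    ∃ (p' : AffinePoint d) (t₁ t₂ t₃ : ℝ), dist p' p < ε ∧ 0 < t₁ ∧ t₁ ≤ t₂ ∧ t₂ ≤ t₃ ∧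
      t₃ ≤ 1 / 4 ∧ p'.HasDip t₁ t₂ t₃ := by
  set Q := p.sumAt with hQ
  have hQc : Continuous Q := p.continuous_sumAt
  have hd0 : (0 : ℝ) < d := by exact_mod_cast NeZero.pos d
  have hQ0 : Q 0 = d / (d + 1) := p.coordSum_truncSimplex_zero
  -- At t = 0 the value is d/(d + 1), strictly between 0 and 1, for every affine point.
  obtain ⟨b, hb, hb', hbQ⟩ : ∃ b > 0, b ≤ 1 / 4 ∧ ∀ t, 0 < t → t ≤ b → t < Q t ∧ Q t < 1 := by
    have hev : ∀ᶠ t in 𝓝[≥] (0 : ℝ), t < Q t ∧ Q t < 1 := by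
      refine nhdsWithin_le_nhds (((isOpen_lt continuous_id hQc).inter
        (isOpen_lt hQc continuous_const)).mem_nhds ⟨?_, ?_⟩)
      · change (0 : ℝ) < Q 0
        rw [hQ0]; positivity
      · change Q 0 < 1
        rw [hQ0, div_lt_one (by positivity)]; linarith
    obtain ⟨u, hu, hu'⟩ := mem_nhdsGE_iff_exists_Icc_subset.1 hev
    exact ⟨min u (1 / 4), lt_min hu (by norm_num), min_le_right _ _,
      fun t h1 h2 => hu' ⟨h1.le, h2.trans (min_le_left _ _)⟩⟩
  obtain ⟨κ, hκ, a, s, ha, has, hsb, hη, hmono⟩ := exists_coreMoment_ne_zero hd hb hb'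
  set R : ℝ → ℝ := fun t => coreRatio hκ (truncSimplex d t) with hR
  set η : ℝ → ℝ := fun t => coordSum d (coreMoment hκ (truncSimplex d t)) with hηdef
  have hRc : Continuous R := (continuous_coreRatio hκ).comp (continuous_truncSimplex d)
  have hηc : Continuous η :=
    (coordSum d).continuous.comp ((continuous_coreMoment hκ).comp (continuous_truncSimplex d))
  change η s < 0 at hη
  obtain ⟨M, hM⟩ := AffinePoint.exists_dist_perturb_le κ hκ p
  have hs0 : 0 < s := ha.trans has
  obtain ⟨hsQ, hsQ1⟩ := hbQ s hs0 hsb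
  obtain ⟨δ, hδ, hδ1, hδ2⟩ : ∃ δ > 0, δ * M < ε ∧ Q s - δ * η s < 1 := by
    have h1 : ∀ᶠ δ in 𝓝[>] (0 : ℝ), δ * M < ε ∧ Q s - δ * η s < 1 := by
      have c1 : Tendsto (fun δ : ℝ => δ * M) (𝓝[>] 0) (𝓝 (0 * M)) :=
        ((continuous_mul_const M).tendsto 0).mono_left nhdsWithin_le_nhds
      have c2 : Tendsto (fun δ : ℝ => Q s - δ * η s) (𝓝[>] 0) (𝓝 (Q s - 0 * η s)) :=
        ((continuous_const.sub (continuous_mul_const (η s))).tendsto 0).mono_left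
          nhdsWithin_le_nhds
      exact (c1.eventually_lt_const (by simpa using hε)).and
        (c2.eventually_lt_const (by simpa using hsQ1))
    obtain ⟨δ, h2, h3⟩ := (h1.and self_mem_nhdsWithin).exists
    exact ⟨δ, h3, h2⟩
  set Q₁ : ℝ → ℝ := fun t => Q t - δ * η t with hQ₁
  have hQ₁c : Continuous Q₁ := by fun_prop
  have hQQ₁ : Q s < Q₁ s := by
    have := mul_neg_of_pos_of_neg hδ hη
    simp only [hQ₁]; linarith
  have hs4 : s ≤ 1 / 4 := hsb.trans hb'
  -- Near s, the level m separates the cross-ratios of the unperturbed Q from those of the fully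
  -- perturbed Q₁. A perturbation that is full at t₂ and absent at t₁ and s therefore makes a dip.
  obtain ⟨m, hm, hm'⟩ := exists_between
    (crossRatio_lt hs0 (show s < 1 by linarith) (hs0.trans hsQ) hQQ₁)
  have hcr (F : ℝ → ℝ) (hF : Continuous F) (h0 : 0 < F s) :
      Tendsto (fun t => crossRatio t (F t)) (𝓝 s) (𝓝 (crossRatio s (F s))) :=
    (continuousAt_crossRatio h0.ne' (show s ≠ 1 by linarith)).comp
      (f := fun t => (t, F t)) (continuous_id.prodMk hF).continuousAt
  have hnear : ∀ᶠ t in 𝓝[≤] s, η t < 0 ∧ Q₁ t < 1 ∧ crossRatio t (Q₁ t) < m ∧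
      m < crossRatio t (Q t) := by
    refine nhdsWithin_le_nhds ?_
    filter_upwards [(isOpen_lt hηc continuous_const).mem_nhds hη,
      (isOpen_lt hQ₁c continuous_const).mem_nhds hδ2,
      (hcr Q₁ hQ₁c ((hs0.trans hsQ).trans hQQ₁)).eventually_lt_const hm,
      (hcr Q hQc (hs0.trans hsQ)).eventually_const_lt hm'] with t h1 h2 h3 h4
    exact ⟨h1, h2, h3, h4⟩
  obtain ⟨l, hl, hl'⟩ := (mem_nhdsLE_iff_exists_Ioc_subset' has).1 hnear
  obtain ⟨t₁, ht₁, ht₁s⟩ := exists_between (max_lt hl has)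
  have hlt₁ : l < t₁ := (le_max_left _ _).trans_lt ht₁
  have hat₁ : a < t₁ := (le_max_right _ _).trans_lt ht₁
  have ht₁0 : 0 < t₁ := ha.trans hat₁
  have hU (t : ℝ) (ht : t ∈ Set.Icc t₁ s) : η t < 0 ∧ Q₁ t < 1 ∧ crossRatio t (Q₁ t) < m ∧
      m < crossRatio t (Q t) := hl' ⟨hlt₁.trans_le ht.1, ht.2⟩
  have hR1 : R t₁ < R s := hmono t₁ hat₁.le ht₁s
  -- R(t₂) is the midpoint of R(t₁) and R(s), so a tent of half-width ρ centred there is 1 at R(t₂)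
  -- and 0 at both ends.
  obtain ⟨t₂, ht₂, hR2⟩ := intermediate_value_Icc ht₁s.le hRc.continuousOn
    (show (R t₁ + R s) / 2 ∈ Set.Icc (R t₁) (R s) from ⟨by linarith, by linarith⟩)
  set ρ := (R s - R t₁) / 2 with hρ
  have hρ0 : 0 < ρ := by rw [hρ]; linarith
  set ψ : ℝ → ℝ := fun x => max 0 (1 - |x - R t₂| / ρ) with hψdef
  have hψ : Continuous ψ :=
    continuous_const.max (continuous_const.sub ((continuous_id.sub continuous_const).abs.div_const ρ))
  have hψ0 (x : ℝ) : 0 ≤ ψ x := le_max_left _ _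
  have hψ1 (x : ℝ) : ψ x ≤ 1 := max_le zero_le_one (by
    have : 0 ≤ |x - R t₂| / ρ := by positivity
    linarith)
  have hψt₂ : ψ (R t₂) = 1 := by simp [hψdef]
  have hψt₁ : ψ (R t₁) = 0 := by
    have : |R t₁ - R t₂| = ρ := by
      rw [hR2, abs_of_neg (by linarith), hρ]; ring
    simp [hψdef, this, hρ0.ne']
  have hψs : ψ (R s) = 0 := by
    have : |R s - R t₂| = ρ := by
      rw [hR2, abs_of_pos (by linarith), hρ]; ring
    simp [hψdef, this, hρ0.ne']
  set p' := p.perturb hκ δ ψ hψ with hp'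
  have hsum (t : ℝ) : p'.sumAt t = Q t - δ * ψ (R t) * η t := by
    rw [AffinePoint.sumAt, hp', AffinePoint.perturb_apply, map_sub, map_smul, smul_eq_mul]
    rfl
  refine ⟨p', t₁, t₂, s, (hM δ ψ hψ hδ.le fun x => ?_).trans_lt hδ1, ht₁0, ht₂.1, ht₂.2, hs4,
    fun t ht => ?_, fun t ht => ?_, ?_, ?_⟩
  · rw [abs_of_nonneg (hψ0 x)]
    exact hψ1 x
  · have h1 := (hbQ t (ht₁0.trans_le ht.1) (ht.2.trans hsb)).1
    have h2 : δ * ψ (R t) * η t ≤ 0 :=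
      mul_nonpos_of_nonneg_of_nonpos (mul_nonneg hδ.le (hψ0 _)) (hU t ht).1.le
    rw [hsum]
    linarith
  · have h1 : Q t - δ * η t < 1 := (hU t ht).2.1
    have h2 := mul_nonneg (mul_nonneg hδ.le (sub_nonneg.2 (hψ1 (R t))))
      (neg_nonneg.2 (hU t ht).1.le)
    rw [hsum]
    nlinarith
  · rw [hsum, hsum, hψt₂, hψt₁, mul_one, mul_zero, zero_mul, sub_zero]
    exact (hU t₂ ht₂).2.2.1.trans (hU t₁ ⟨le_rfl, ht₁s.le⟩).2.2.2
  · rw [hsum, hsum, hψt₂, hψs, mul_one, mul_zero, zero_mul, sub_zero]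
    exact (hU t₂ ht₂).2.2.1.trans (hU s ⟨ht₁s.le, le_rfl⟩).2.2.2

end Dip

end AffinePoints

/-- For `d ≥ 2`, the space of affine points of `d`-dimensional convex bodies contains an open and
dense set of affine points that have no dual. -/
theorem theorem1p3 (d : ℕ) (hd : 2 ≤ d) :
    ∃ W : Set (AffinePoints.AffinePoint d), IsOpen W ∧ Dense W ∧
      ∀ p ∈ W, ¬ ∃ q : AffinePoints.AffinePoint d, p.IsDual q := by
  have : NeZero d := ⟨by omega⟩
  refine ⟨interior {p : AffinePoints.AffinePoint d | ¬ ∃ q, p.IsDual q}, isOpen_interior, ?_,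
    fun p hp => interior_subset (s := {p : AffinePoints.AffinePoint d | ¬ ∃ q, p.IsDual q}) hp⟩
  rw [Metric.dense_iff]
  intro p ε hε
  obtain ⟨p', t₁, t₂, t₃, hdist, h₁, h₁₂, h₂₃, h₃, hdip⟩ := p.exists_dist_lt_hasDip hd hε
  refine ⟨p', hdist, mem_interior_iff_mem_nhds.2 ?_⟩
  filter_upwards [hdip.eventually hd h₁ h₁₂ h₂₃ h₃] with q hq
  exact hq.not_exists_isDual h₁ h₁₂ h₂₃ h₃
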